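/- Let $M$ be an oriented $n$-dimensional manifold with an atlas of class $C^2$, and let $x\in M$. Let $\mathrm{Met}(M)$ be the set of locally Lipschitz-$C^1$ Riemannian metrics on $M$, i.e. Riemannian metrics of class $C^1$ whose coefficients $g_{ij}$ in every chart of the atlas have locally Lipschitz first derivatives, equipped with the compact-open $C^1$-topology (uniform convergence of the coefficients and of their first derivatives on compact subsets of chart domains). For $h\in\mathrm{Met}(M)$ let $\mathrm{Hol}_x(h)$ be the holonomy group of the Levi-Civita connection of $h$ at $x$, that is, the set of all parallel transports $T_xM\to T_xM$ along piecewise $C^1$ loops $c:[0,1]\to M$ based at $x$. For a subgroup $H\subseteq\mathrm{SO}(n)$, we say that $\mathrm{Hol}_x(h)\subseteq H$ up to conjugation in $\mathrm{SO}(n)$ if, after identifying $T_xM$ with $\mathbb R^n$ by some positively oriented $h$-orthonormal basis, there is $U\in \mathrm{SO}(n)$ with $U\,\mathrm{Hol}_x(h)\,U^{-1}\subseteq H$. Let $H\subseteq \mathrm{SO}(n)$ be a closed subgroup, let $g\in\mathrm{Met}(M)$ and $g_k\in\mathrm{Met}(M)$ for $k\in\mathbb N$, and assume that $g_k\to g$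 in $\mathrm{Met}(M)$ and that for all $k\in\mathbb N$ we have $\mathrm{Hol}_x(g_k)\subseteq H$ up to conjugation in $\mathrm{SO}(n)$. Then $\mathrm{Hol}_x(g)\subseteq H$ up to conjugation in $\mathrm{SO}(n)$. -/

import Mathlib

open scoped Manifold ContDiff Topology Matrix
open Set Filter Bundle

noncomputable section

namespace RiemannianHolonomy

section Metrics

variable {n : ℕ} {M : Type*} [TopologicalSpace M] [ChartedSpace (EuclideanSpace ℝ (Fin n)) M]

/-- The coordinate vector field `∂ᵢ` of the chart `e`, at the point with coordinates `y`. -/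
def coordVector (e : OpenPartialHomeomorph M (EuclideanSpace ℝ (Fin n)))
    (y : EuclideanSpace ℝ (Fin n)) (i : Fin n) : TangentSpace (𝓡 n) (e.symm y) :=
  mfderiv (𝓡 n) (𝓡 n) e.symm y
    (EuclideanSpace.single i (1 : ℝ) : EuclideanSpace ℝ (Fin n))

variable [IsManifold (𝓡 n) 2 M]

/-- Riemannian metrics of class `C¹` on `M`. -/
abbrev C1Metric (n : ℕ) (M : Type*) [TopologicalSpace M]
    [ChartedSpace (EuclideanSpace ℝ (Fin n)) M] [IsManifold (𝓡 n) 2 M] :=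
  ContMDiffRiemannianMetric (𝓡 n) 1 (EuclideanSpace ℝ (Fin n))
    (fun p : M => TangentSpace (𝓡 n) p)

/-- The coefficient `gᵢⱼ` of the metric `g` in the chart `e`, as a function of the coordinates
(meaningful on `e.target`). -/
def coeff (g : C1Metric n M) (e : OpenPartialHomeomorph M (EuclideanSpace ℝ (Fin n)))
    (i j : Fin n) (y : EuclideanSpace ℝ (Fin n)) : ℝ :=
  g.inner (e.symm y) (coordVector e y i) (coordVector e y j)

/-- The matrix `(gᵢⱼ)` of the metric `g` in the chart `e`. -/
def gram (g : C1Metric n M) (e : OpenPartialHomeomorph M (EuclideanSpace ℝ (Fin n)))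
    (y : EuclideanSpace ℝ (Fin n)) : Matrix (Fin n) (Fin n) ℝ :=
  Matrix.of fun i j => coeff g e i j y

/-- The partial derivative `∂ₖ gᵢⱼ` in the chart `e`. -/
def dcoeff (g : C1Metric n M) (e : OpenPartialHomeomorph M (EuclideanSpace ℝ (Fin n)))
    (k i j : Fin n) (y : EuclideanSpace ℝ (Fin n)) : ℝ :=
  fderiv ℝ (coeff g e i j) y (EuclideanSpace.single k (1 : ℝ))

/-- `Met(M)`: the locally Lipschitz-`C¹` Riemannian metrics, that is, those metrics of class `C¹`
whose coefficients have locally Lipschitz first derivatives in the charts of `M`. -/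
def Met (n : ℕ) (M : Type*) [TopologicalSpace M]
    [ChartedSpace (EuclideanSpace ℝ (Fin n)) M] [IsManifold (𝓡 n) 2 M] :=
  {g : C1Metric n M // ∀ e ∈ atlas (EuclideanSpace ℝ (Fin n)) M, ∀ i j : Fin n,
    LocallyLipschitzOn e.target (fderiv ℝ (coeff g e i j))}

/-- The basic open sets of the compact-open `C¹`-topology: the metrics whose coefficients in the
chart `e` are `ε`-close to those of `f` on the compact set `K`, together with their first
derivatives. -/
def Met.basicSet (f : Met n M) (e : OpenPartialHomeomorph M (EuclideanSpace ℝ (Fin n)))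
    (K : Set M) (ε : ℝ) : Set (Met n M) :=
  {h | ∀ p ∈ K, ∀ i j : Fin n,
    |coeff f.1 e i j (e p) - coeff h.1 e i j (e p)| < ε ∧
    ‖fderiv ℝ (coeff f.1 e i j) (e p) - fderiv ℝ (coeff h.1 e i j) (e p)‖ < ε}

/-- The compact-open `C¹`-topology on `Met(M)`. -/
instance Met.topology : TopologicalSpace (Met n M) :=
  TopologicalSpace.generateFrom
    {B | ∃ (f : Met n M) (e : OpenPartialHomeomorph M (EuclideanSpace ℝ (Fin n))) (K : Set M)
      (ε : ℝ), e ∈ atlas (EuclideanSpace ℝ (Fin n)) M ∧ IsCompact K ∧ K ⊆ e.source ∧ 0 < ε ∧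
        B = Met.basicSet f e K ε}

/-- The Christoffel symbol `Γᵏᵢⱼ` of the Levi-Civita connection of `g` in the chart `e`. -/
def christoffel (g : C1Metric n M) (e : OpenPartialHomeomorph M (EuclideanSpace ℝ (Fin n)))
    (y : EuclideanSpace ℝ (Fin n)) (k i j : Fin n) : ℝ :=
  1 / 2 * ∑ l, (gram g e y)⁻¹ k l *
    (dcoeff g e i j l y + dcoeff g e j i l y - dcoeff g e l i j y)

end Metrics

section LeviCivita

variable {n : ℕ} {M : Type*} [TopologicalSpace M] [ChartedSpace (EuclideanSpace ℝ (Fin n)) M]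
  [IsManifold (𝓡 n) 2 M]

lemma coeff_symm (g : C1Metric n M) (e : OpenPartialHomeomorph M (EuclideanSpace ℝ (Fin n)))
    (i j : Fin n) : coeff g e i j = coeff g e j i := by
  funext y; exact g.symm _ _ _

/-- The connection with the coefficients `christoffel g e` is torsion-free. -/
lemma christoffel_symm (g : C1Metric n M)
    (e : OpenPartialHomeomorph M (EuclideanSpace ℝ (Fin n)))
    (y : EuclideanSpace ℝ (Fin n)) (k i j : Fin n) :
    christoffel g e y k i j = christoffel g e y k j i := by
  unfold christoffel
  congr 1
  refine Finset.sum_congr rfl fun l _ => ?_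
  have : dcoeff g e l i j y = dcoeff g e l j i y := by unfold dcoeff; rw [coeff_symm]
  rw [this]; ring

lemma gram_mul_inv (g : C1Metric n M) {e : OpenPartialHomeomorph M (EuclideanSpace ℝ (Fin n))}
    (he : e ∈ atlas (EuclideanSpace ℝ (Fin n)) M) {y : EuclideanSpace ℝ (Fin n)}
    (hy : y ∈ e.target) : gram g e y * (gram g e y)⁻¹ = 1 := by
  have hM : e.MDifferentiable (𝓡 n) (𝓡 n) := mdifferentiable_of_mem_atlas he
  apply Matrix.mul_nonsing_inv
  rw [isUnit_iff_ne_zero]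
  intro hdet
  obtain ⟨v, hv, hv0⟩ := Matrix.exists_mulVec_eq_zero_iff.2 hdet
  set D : EuclideanSpace ℝ (Fin n) →L[ℝ] TangentSpace (𝓡 n) (e.symm y) :=
    mfderiv (𝓡 n) (𝓡 n) e.symm y with hD
  set w : TangentSpace (𝓡 n) (e.symm y) := ∑ i, v i • coordVector e y i with hw
  have hwD : w = D (WithLp.toLp 2 v) := by
    have h1 : WithLp.toLp 2 v = ∑ i, v i • EuclideanSpace.single i (1 : ℝ) := by
      ext k; simp [Finset.sum_apply, Pi.single_apply]
    rw [h1, map_sum, hw]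
    refine Finset.sum_congr rfl fun i _ => ?_
    rw [map_smul]; rfl
  have hw0 : w ≠ 0 := by
    intro h
    have hinj : Function.Injective D := (hM.symm.mfderiv hy).injective
    have h2 : WithLp.toLp 2 v = 0 := hinj (by rw [← hwD, h, map_zero])
    exact hv (by simpa using congrArg (WithLp.ofLp) h2)
  have hpos := g.pos _ w hw0
  have hzero : g.inner (e.symm y) w w = v ⬝ᵥ (gram g e y *ᵥ v) := by
    simp only [hw, map_sum, map_smul, _root_.sum_apply, _root_.smul_apply,
      smul_eq_mul, dotProduct, Matrix.mulVec, gram, Matrix.of_apply, coeff, Finset.mul_sum]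
    rw [Finset.sum_comm]
    refine Finset.sum_congr rfl fun i _ => Finset.sum_congr rfl fun j _ => ?_
    ring
  rw [hzero, hv0] at hpos
  simp at hpos

/-- The connection with the coefficients `christoffel g e` is compatible with the metric:
`∂ₖ gᵢⱼ = Γˡₖᵢ gₗⱼ + Γˡₖⱼ gᵢₗ`. -/
lemma christoffel_compatible (g : C1Metric n M)
    {e : OpenPartialHomeomorph M (EuclideanSpace ℝ (Fin n))}
    (he : e ∈ atlas (EuclideanSpace ℝ (Fin n)) M) {y : EuclideanSpace ℝ (Fin n)}
    (hy : y ∈ e.target) (k i j : Fin n) :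
    dcoeff g e k i j y = ∑ l, christoffel g e y l k i * coeff g e l j y +
      ∑ l, christoffel g e y l k j * coeff g e i l y := by
  have low : ∀ a b c : Fin n, ∑ l, coeff g e c l y * christoffel g e y l a b =
      1 / 2 * (dcoeff g e a b c y + dcoeff g e b a c y - dcoeff g e c a b y) := by
    intro a b c
    have h := congrFun (congrArg (fun A : Matrix (Fin n) (Fin n) ℝ => A *ᵥ
      (fun l => 1 / 2 * (dcoeff g e a b l y + dcoeff g e b a l y - dcoeff g e l a b y)))
      (gram_mul_inv g he hy)) c
    simp only [Matrix.one_mulVec, ← Matrix.mulVec_mulVec] at h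
    rw [← h]
    simp only [Matrix.mulVec, dotProduct, gram, Matrix.of_apply, christoffel]
    refine Finset.sum_congr rfl fun l _ => ?_
    rw [Finset.mul_sum]
    congr 1
    exact Finset.sum_congr rfl fun m _ => by ring
  have h1 : ∑ l, christoffel g e y l k i * coeff g e l j y =
      ∑ l, coeff g e j l y * christoffel g e y l k i :=
    Finset.sum_congr rfl fun l _ => by rw [coeff_symm g e l j]; ring
  have h2 : ∑ l, christoffel g e y l k j * coeff g e i l y =
      ∑ l, coeff g e i l y * christoffel g e y l k j :=
    Finset.sum_congr rfl fun l _ => by ring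
  rw [h1, h2, low, low]
  have s1 : dcoeff g e k j i y = dcoeff g e k i j y := by unfold dcoeff; rw [coeff_symm]
  have s2 : dcoeff g e i k j y = dcoeff g e i j k y := by unfold dcoeff; rw [coeff_symm]
  have s3 : dcoeff g e j k i y = dcoeff g e j i k y := by unfold dcoeff; rw [coeff_symm]
  rw [s1, s2, s3]
  ring

end LeviCivita

section Holonomy

variable {n : ℕ} {M : Type*} [TopologicalSpace M] [ChartedSpace (EuclideanSpace ℝ (Fin n)) M]

/-- A loop `c : [0,1] → M` based at `x` is piecewise `C¹`: for some subdivision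
`0 = t₀ ≤ ⋯ ≤ tₘ = 1`, its restriction to each closed subinterval is of class `C¹`. -/
def IsPiecewiseC1 (n : ℕ) {M : Type*} [TopologicalSpace M]
    [ChartedSpace (EuclideanSpace ℝ (Fin n)) M] {x : M} (c : Path x x) : Prop :=
  ∃ (m : ℕ) (t : ℕ → ℝ), Monotone t ∧ t 0 = 0 ∧ t m = 1 ∧
    ∀ i < m, ContMDiffOn 𝓘(ℝ, ℝ) (𝓡 n) 1 c.extend (Icc (t i) (t (i + 1)))

/-- The `k`-th component of the tangent vector `v` in the chart `e`. -/
def component (e : OpenPartialHomeomorph M (EuclideanSpace ℝ (Fin n)))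
    (v : TangentBundle (𝓡 n) M) (k : Fin n) : ℝ :=
  let w : EuclideanSpace ℝ (Fin n) := mfderiv (𝓡 n) (𝓡 n) e v.proj v.2
  w k

variable [IsManifold (𝓡 n) 2 M]

/-- `s` is a parallel vector field along the loop `c` for the Levi-Civita connection of `g`: it is a
continuous field along `c` and, outside finitely many parameter values (such as the break points
of `c`), it solves `∇_ċ s = 0`, which in every chart around `c t` reads
`(sᵏ)' = - Γᵏᵢⱼ (cⁱ)' sʲ`. -/
def IsParallelAlong (g : C1Metric n M) {x : M} (c : Path x x)
    (s : ℝ → TangentBundle (𝓡 n) M) : Prop :=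
  ContinuousOn s (Icc 0 1) ∧ (∀ t ∈ Icc (0 : ℝ) 1, (s t).proj = c.extend t) ∧
  ∃ S : Set ℝ, S.Finite ∧ ∀ t ∈ Ioo (0 : ℝ) 1 \ S,
    ∀ e ∈ atlas (EuclideanSpace ℝ (Fin n)) M, c.extend t ∈ e.source → ∀ k : Fin n,
      HasDerivAt (fun τ => component e (s τ) k)
        (-∑ i, ∑ j, christoffel g e (e (c.extend t)) k i j *
          deriv (fun τ => e (c.extend τ) i) t * component e (s t) j) t

/-- The linear map `P` is the parallel transport `T_xM → T_xM` along the loop `c`. -/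
def IsParallelTransport (g : C1Metric n M) {x : M} (c : Path x x)
    (P : TangentSpace (𝓡 n) x →ₗ[ℝ] TangentSpace (𝓡 n) x) : Prop :=
  ∀ v : TangentSpace (𝓡 n) x, ∃ s : ℝ → TangentBundle (𝓡 n) M,
    IsParallelAlong g c s ∧ s 0 = ⟨x, v⟩ ∧ s 1 = ⟨x, P v⟩

/-- The holonomy group `Hol_x(g)`: all parallel transports of the Levi-Civita connection of `g`
along piecewise `C¹` loops based at `x`. -/
def Hol (g : C1Metric n M) (x : M) :
    Set (TangentSpace (𝓡 n) x →ₗ[ℝ] TangentSpace (𝓡 n) x) :=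
  {P | ∃ c : Path x x, IsPiecewiseC1 n c ∧ IsParallelTransport g c P}

/-- An orientation of `M`: an orientation of every tangent space which is locally constant when
read in the charts of `M`. -/
structure ManifoldOrientation (n : ℕ) (M : Type*) [TopologicalSpace M]
    [ChartedSpace (EuclideanSpace ℝ (Fin n)) M] [IsManifold (𝓡 n) 2 M] where
  /-- the orientation of the tangent space at a point -/
  at_point : ∀ p : M, Orientation ℝ (TangentSpace (𝓡 n) p) (Fin n)
  /-- in a chart, the orientation is locally constant -/
  locally_constant : ∀ (e : OpenPartialHomeomorph M (EuclideanSpace ℝ (Fin n)))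
    (he : e ∈ atlas (EuclideanSpace ℝ (Fin n)) M) (p : M) (hp : p ∈ e.source),
    ∀ᶠ q in 𝓝 p, ∀ hq : q ∈ e.source,
      (Orientation.map (Fin n)
        ((mdifferentiable_of_mem_atlas (I := 𝓡 n) he).mfderiv hq).toLinearEquiv (at_point q) :
          Orientation ℝ (EuclideanSpace ℝ (Fin n)) (Fin n)) =
      Orientation.map (Fin n)
        ((mdifferentiable_of_mem_atlas (I := 𝓡 n) he).mfderiv hp).toLinearEquiv (at_point p)

/-- `b` is a positively oriented `g`-orthonormal basis of `T_xM`. -/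
def IsPositiveOrthonormal (o : ManifoldOrientation n M) (g : C1Metric n M) {x : M}
    (b : Module.Basis (Fin n) ℝ (TangentSpace (𝓡 n) x)) : Prop :=
  (∀ i j, g.inner x (b i) (b j) = if i = j then 1 else 0) ∧ b.orientation = o.at_point x

/-- `Hol_x(g) ⊆ H` up to conjugation in `SO(n)`: after identifying `T_xM` with `ℝⁿ` by a positively
oriented `g`-orthonormal basis, some conjugate `U Hol_x(g) U⁻¹` with `U ∈ SO(n)` lies in `H`. -/
def HolSubsetUpToConj (o : ManifoldOrientation n M) (g : C1Metric n M) (x : M)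
    (H : Subgroup (Matrix.specialOrthogonalGroup (Fin n) ℝ)) : Prop :=
  ∃ b : Module.Basis (Fin n) ℝ (TangentSpace (𝓡 n) x), IsPositiveOrthonormal o g b ∧
    ∃ U : Matrix.specialOrthogonalGroup (Fin n) ℝ, ∀ P ∈ Hol g x, ∃ A ∈ H,
      (A : Matrix (Fin n) (Fin n) ℝ) =
        (U : Matrix (Fin n) (Fin n) ℝ) * LinearMap.toMatrix b b P *
          ((U⁻¹ : Matrix.specialOrthogonalGroup (Fin n) ℝ) : Matrix (Fin n) (Fin n) ℝ)

end Holonomy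

end RiemannianHolonomy

end

/-! The Christoffel symbols are rational in the metric coefficients and their first derivatives, so
`g_k → g` in the compact-open C¹-topology makes them converge uniformly on compact subsets of chart
domains. Parallel transport along a fixed loop solves a linear differential equation with these
coefficients. By Grönwall's inequality the transports for `g_k` converge to the transport for `g`
(`tendsto_isParallelTransport`).

By assumption there are oriented `g_k`-orthonormal bases `b_k` and rotations `U_k` conjugating
`Hol_x(g_k)` into `H`. The matrices of the `b_k` in a fixed basis are bounded, because the inner
products at `x` converge to a positive definite one, and the `U_k` lie in a compact group. A
subsequence, chosen independently of any loop, converges to an oriented `g`-orthonormal basis and a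
rotation (`exists_subseq_tendsto_conj`). For each loop the conjugated matrices converge along it,
and the limit is in `H` because `H` is closed.

A parallel field must satisfy its equation in every chart. The existence of transports for the `g_k`
(`exists_isParallelTransport`) therefore rests on the transformation law of the Christoffel symbols
(`chris_chartChange`), which is deduced from the Koszul formula. -/

noncomputable section

namespace RiemannianHolonomy

/-! ### Metrics and Christoffel symbols in a chart, in vector form. -/

section Christoffel

variable {n : ℕ} {M : Type*} [TopologicalSpace M] [ChartedSpace (EuclideanSpace ℝ (Fin n)) M]
  [IsManifold (𝓡 n) 2 M]

/-- The derivative of the inverse of the chart `e`, as a linear map of the model space. -/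
def symmD (e : OpenPartialHomeomorph M (EuclideanSpace ℝ (Fin n)))
    (y : EuclideanSpace ℝ (Fin n)) : EuclideanSpace ℝ (Fin n) →L[ℝ] EuclideanSpace ℝ (Fin n) :=
  mfderiv (𝓡 n) (𝓡 n) e.symm y

/-- The metric `g` at `p`, as a bilinear form on the model space. -/
def modelInner (g : C1Metric n M) (p : M) :
    EuclideanSpace ℝ (Fin n) →L[ℝ] EuclideanSpace ℝ (Fin n) →L[ℝ] ℝ :=
  g.inner p

/-- The metric `g` read in the chart `e`, as a bilinear form on the model space. -/
def gramForm (g : C1Metric n M) (e : OpenPartialHomeomorph M (EuclideanSpace ℝ (Fin n)))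
    (y u v : EuclideanSpace ℝ (Fin n)) : ℝ :=
  modelInner g (e.symm y) (symmD e y u) (symmD e y v)

lemma coeff_eq_gramForm (g : C1Metric n M)
    (e : OpenPartialHomeomorph M (EuclideanSpace ℝ (Fin n))) (i j : Fin n)
    (y : EuclideanSpace ℝ (Fin n)) :
    coeff g e i j y = gramForm g e y (EuclideanSpace.single i 1) (EuclideanSpace.single j 1) :=
  rfl

/-- The inverse of a C² chart has a C¹ tangent map, so constant coordinates define a C¹ vector
field. This is why a C¹ metric has differentiable coefficients. -/
lemma contMDiffOn_symm_vector {e : OpenPartialHomeomorph M (EuclideanSpace ℝ (Fin n))}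
    (he : e ∈ atlas (EuclideanSpace ℝ (Fin n)) M) (u : EuclideanSpace ℝ (Fin n)) :
    ContMDiffOn (𝓡 n) (𝓡 n).tangent 1
      (fun y => (⟨e.symm y, mfderiv (𝓡 n) (𝓡 n) e.symm y u⟩ : TangentBundle (𝓡 n) M))
      e.target := by
  have hs : ContMDiffOn (𝓡 n) (𝓡 n) 2 e.symm e.target :=
    contMDiffOn_symm_of_mem_maximalAtlas
      (IsManifold.subset_maximalAtlas (I := 𝓡 n) (n := 2) he)
  have h1 := hs.contMDiffOn_tangentMapWithin (m := 1) (by norm_num)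
    e.open_target.uniqueMDiffOn
  have h2 : ContMDiff (𝓡 n) (𝓡 n).tangent 1
      (fun y => (⟨y, u⟩ : TangentBundle (𝓡 n) (EuclideanSpace ℝ (Fin n)))) := by
    exact contMDiff_vectorSpace_iff_contDiff.2 contDiff_const
  have h3 := h1.comp h2.contMDiffOn (s := e.target) (fun y hy => by simpa using hy)
  refine h3.congr fun y hy => ?_
  simp only [Function.comp, tangentMapWithin, mfderivWithin_of_isOpen e.open_target hy]

lemma differentiableAt_gramForm (g : C1Metric n M)
    {e : OpenPartialHomeomorph M (EuclideanSpace ℝ (Fin n))}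
    (he : e ∈ atlas (EuclideanSpace ℝ (Fin n)) M) {y : EuclideanSpace ℝ (Fin n)}
    (hy : y ∈ e.target) (u v : EuclideanSpace ℝ (Fin n)) :
    DifferentiableAt ℝ (fun z => gramForm g e z u v) y := by
  have hu := (contMDiffOn_symm_vector he u).contMDiffAt (e.open_target.mem_nhds hy)
  have hv := (contMDiffOn_symm_vector he v).contMDiffAt (e.open_target.mem_nhds hy)
  have hs : ContMDiffAt (𝓡 n) (𝓡 n) 1 e.symm y :=
    ((contMDiffOn_symm_of_mem_maximalAtlas
      (IsManifold.subset_maximalAtlas (I := 𝓡 n) (n := 2) he)).contMDiffAt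
        (e.open_target.mem_nhds hy)).of_le (by norm_num)
  have : ContMDiffAt (𝓡 n) ((𝓡 n).prod 𝓘(ℝ)) 1
      (fun m ↦ TotalSpace.mk' ℝ (E := Bundle.Trivial M ℝ) (e.symm m) (gramForm g e m u v)) y := by
    apply ContMDiffAt.clm_bundle_apply₂ (F₁ := EuclideanSpace ℝ (Fin n))
      (F₂ := EuclideanSpace ℝ (Fin n)) (E₁ := fun p : M => TangentSpace (𝓡 n) p)
      (E₂ := fun p : M => TangentSpace (𝓡 n) p)
    · exact ContMDiffAt.comp y g.contMDiff.contMDiffAt hs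
    · exact hu
    · exact hv
  simp only [contMDiffAt_totalSpace] at this
  exact (contMDiffAt_iff_contDiffAt.1 this.2).differentiableAt one_ne_zero

variable (g : C1Metric n M) (e : OpenPartialHomeomorph M (EuclideanSpace ℝ (Fin n)))
  (y : EuclideanSpace ℝ (Fin n))

lemma gramForm_add_left (u u' v : EuclideanSpace ℝ (Fin n)) :
    gramForm g e y (u + u') v = gramForm g e y u v + gramForm g e y u' v := by
  simp [gramForm, map_add]

lemma gramForm_comm (u v : EuclideanSpace ℝ (Fin n)) :
    gramForm g e y u v = gramForm g e y v u := g.symm _ _ _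

lemma gramForm_eq_sum (u v : EuclideanSpace ℝ (Fin n)) :
    gramForm g e y u v = ∑ i, ∑ j, u i * v j * coeff g e i j y := by
  have hsum : ∀ w : EuclideanSpace ℝ (Fin n), w = ∑ i, w i • EuclideanSpace.single i (1 : ℝ) := by
    intro w
    ext k
    simp [Finset.sum_apply, Pi.single_apply]
  simp only [coeff_eq_gramForm, gramForm]
  conv_lhs => rw [hsum u, hsum v]
  simp only [map_sum, map_smul, _root_.sum_apply, _root_.smul_apply, smul_eq_mul, Finset.mul_sum]
  rw [Finset.sum_comm]
  exact Finset.sum_congr rfl fun i _ => Finset.sum_congr rfl fun j _ => by ring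

/-- The vector with the components `Γᵏᵢⱼ uⁱ vʲ`. -/
def chris (u v : EuclideanSpace ℝ (Fin n)) : EuclideanSpace ℝ (Fin n) :=
  WithLp.toLp 2 fun k => ∑ i, ∑ j, christoffel g e y k i j * u i * v j

lemma chris_comm (u v : EuclideanSpace ℝ (Fin n)) : chris g e y u v = chris g e y v u := by
  ext k
  simp only [chris]
  rw [Finset.sum_comm]
  exact Finset.sum_congr rfl fun i _ => Finset.sum_congr rfl fun j _ => by
    rw [christoffel_symm]; ring

variable {e y}

lemma fderiv_gramForm_eq_sum (he : e ∈ atlas (EuclideanSpace ℝ (Fin n)) M) (hy : y ∈ e.target)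
    (a u v : EuclideanSpace ℝ (Fin n)) :
    fderiv ℝ (fun z => gramForm g e z u v) y a =
      ∑ i, ∑ j, u i * v j * fderiv ℝ (coeff g e i j) y a := by
  have h : HasFDerivAt (fun z => gramForm g e z u v)
      (∑ i, ∑ j, (u i * v j) • fderiv ℝ (coeff g e i j) y) y := by
    simp only [gramForm_eq_sum]
    exact HasFDerivAt.fun_sum fun i _ => HasFDerivAt.fun_sum fun j _ =>
      (differentiableAt_gramForm g he hy _ _).hasFDerivAt.const_mul _
  rw [h.fderiv]
  simp [_root_.sum_apply]

lemma fderiv_coeff_eq_sum (a : EuclideanSpace ℝ (Fin n)) (i j : Fin n) :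
    fderiv ℝ (coeff g e i j) y a = ∑ k, a k * dcoeff g e k i j y := by
  have hsum : a = ∑ i, a i • EuclideanSpace.single i (1 : ℝ) := by
    ext k
    simp [Finset.sum_apply, Pi.single_apply]
  conv_lhs => rw [hsum]
  simp [dcoeff]

/-- Metric compatibility without indices: `christoffel_compatible` contracted with `a`, `u`, `v`.
The rest of the proof permutes finite sums. -/
lemma fderiv_gramForm_eq_chris (he : e ∈ atlas (EuclideanSpace ℝ (Fin n)) M) (hy : y ∈ e.target)
    (a u v : EuclideanSpace ℝ (Fin n)) :
    fderiv ℝ (fun z => gramForm g e z u v) y a =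
      gramForm g e y (chris g e y a u) v + gramForm g e y u (chris g e y a v) := by
  rw [fderiv_gramForm_eq_sum g he hy]
  simp only [fderiv_coeff_eq_sum, christoffel_compatible g he hy, gramForm_eq_sum, chris,
    mul_add, Finset.sum_add_distrib, Finset.mul_sum, Finset.sum_mul]
  congr 1
  · calc _ = ∑ j, ∑ i, ∑ k, ∑ l, u i * (v j * (a k * (christoffel g e y l k i *
          coeff g e l j y))) := by
          rw [Finset.sum_comm]; simp only [mul_assoc]
      _ = ∑ j, ∑ l, ∑ k, ∑ i, u i * (v j * (a k * (christoffel g e y l k i *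
          coeff g e l j y))) := by
          refine Finset.sum_congr rfl fun j _ => ?_
          calc _ = ∑ i, ∑ l, ∑ k, u i * (v j * (a k * (christoffel g e y l k i *
                coeff g e l j y))) := Finset.sum_congr rfl fun i _ => Finset.sum_comm
            _ = ∑ l, ∑ i, ∑ k, u i * (v j * (a k * (christoffel g e y l k i *
                coeff g e l j y))) := Finset.sum_comm
            _ = _ := Finset.sum_congr rfl fun l _ => Finset.sum_comm
      _ = _ := by
          rw [Finset.sum_comm]
          refine Finset.sum_congr rfl fun l _ => Finset.sum_congr rfl fun j _ =>
            Finset.sum_congr rfl fun k _ => Finset.sum_congr rfl fun i _ => by ring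
  · refine Finset.sum_congr rfl fun i _ => ?_
    calc _ = ∑ j, ∑ l, ∑ k, u i * v j * (a k * (christoffel g e y l k j *
          coeff g e i l y)) := Finset.sum_congr rfl fun j _ => Finset.sum_comm
      _ = ∑ l, ∑ j, ∑ k, u i * v j * (a k * (christoffel g e y l k j *
          coeff g e i l y)) := Finset.sum_comm
      _ = ∑ l, ∑ k, ∑ j, u i * v j * (a k * (christoffel g e y l k j *
          coeff g e i l y)) := Finset.sum_congr rfl fun l _ => Finset.sum_comm
      _ = _ := Finset.sum_congr rfl fun l _ => Finset.sum_congr rfl fun k _ =>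
          Finset.sum_congr rfl fun j _ => by ring

/-- The Koszul formula for coordinate fields. -/
lemma gramForm_chris (he : e ∈ atlas (EuclideanSpace ℝ (Fin n)) M) (hy : y ∈ e.target)
    (u v w : EuclideanSpace ℝ (Fin n)) :
    gramForm g e y (chris g e y u v) w =
      1 / 2 * (fderiv ℝ (fun z => gramForm g e z v w) y u +
        fderiv ℝ (fun z => gramForm g e z u w) y v -
        fderiv ℝ (fun z => gramForm g e z u v) y w) := by
  simp only [fderiv_gramForm_eq_chris g he hy]
  -- By the symmetry of `Γ` and of the metric, the terms with `Γ(u, w)` and `Γ(v, w)` cancel, and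
  -- the pairing of `Γ(u, v)` with `w` occurs twice.
  rw [chris_comm g e y v u, chris_comm g e y w u, chris_comm g e y w v,
    gramForm_comm g e y v, gramForm_comm g e y u (chris g e y v w)]
  ring

lemma symmD_injective (he : e ∈ atlas (EuclideanSpace ℝ (Fin n)) M) (hy : y ∈ e.target) :
    Function.Injective (symmD e y) :=
  ((mdifferentiable_of_mem_atlas (I := 𝓡 n) he).symm.mfderiv hy).injective

/-- Positive definiteness, applied to `a - b`. It reduces identities between Christoffel vectors to
the Koszul formula. -/
lemma eq_of_gramForm_eq (he : e ∈ atlas (EuclideanSpace ℝ (Fin n)) M) (hy : y ∈ e.target)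
    {a b : EuclideanSpace ℝ (Fin n)} (h : ∀ w, gramForm g e y a w = gramForm g e y b w) :
    a = b := by
  by_contra hab
  have h0 : symmD e y (a - b) ≠ 0 := fun h0 => hab <| sub_eq_zero.1 <|
    symmD_injective he hy (h0.trans (map_zero _).symm)
  have hpos : 0 < gramForm g e y (a - b) (a - b) := g.pos _ _ h0
  have h1 := h (a - b)
  have h2 : gramForm g e y (a - b) (a - b) + gramForm g e y b (a - b) =
      gramForm g e y a (a - b) := by rw [← gramForm_add_left, sub_add_cancel]
  linarith

lemma hasDerivAt_gramForm (he : e ∈ atlas (EuclideanSpace ℝ (Fin n)) M) {t : ℝ}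
    {z α β : ℝ → EuclideanSpace ℝ (Fin n)} {z' α' β' : EuclideanSpace ℝ (Fin n)}
    (hz : z t ∈ e.target) (dz : HasDerivAt z z' t) (dα : HasDerivAt α α' t)
    (dβ : HasDerivAt β β' t) :
    HasDerivAt (fun τ => gramForm g e (z τ) (α τ) (β τ))
      (gramForm g e (z t) α' (β t) + gramForm g e (z t) (α t) β' +
        fderiv ℝ (fun y => gramForm g e y (α t) (β t)) (z t) z') t := by
  rw [fderiv_gramForm_eq_sum g he hz]
  simp only [gramForm_eq_sum]
  have hproj : ∀ {f : ℝ → EuclideanSpace ℝ (Fin n)} {f' : EuclideanSpace ℝ (Fin n)}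
      (_ : HasDerivAt f f' t) (i : Fin n), HasDerivAt (fun τ => f τ i) (f' i) t := by
    intro f f' hf i
    exact (EuclideanSpace.proj (𝕜 := ℝ) i).hasFDerivAt.comp_hasDerivAt t hf
  have h : HasDerivAt (fun τ => ∑ i, ∑ j, α τ i * β τ j * coeff g e i j (z τ))
      (∑ i, ∑ j, ((α' i * β t j + α t i * β' j) * coeff g e i j (z t) +
        α t i * β t j * fderiv ℝ (coeff g e i j) (z t) z')) t :=
    HasDerivAt.fun_sum fun i _ => HasDerivAt.fun_sum fun j _ =>
      ((hproj dα i).mul (hproj dβ j)).mul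
        ((differentiableAt_gramForm g he hz _ _).hasFDerivAt.comp_hasDerivAt t dz)
  convert h using 1
  simp only [← Finset.sum_add_distrib]
  exact Finset.sum_congr rfl fun i _ => Finset.sum_congr rfl fun j _ => by ring

end Christoffel

/-! ### Behaviour of metric and Christoffel symbols under a change of charts. -/

section ChartChange

variable {n : ℕ} {M : Type*} [TopologicalSpace M]

lemma eventually_chartChange {e e' : OpenPartialHomeomorph M (EuclideanSpace ℝ (Fin n))}
    {y : EuclideanSpace ℝ (Fin n)} (hy : y ∈ e.target) (hy' : e.symm y ∈ e'.source) :
    ∀ᶠ z in 𝓝 y, z ∈ e.target ∧ e.symm z ∈ e'.source :=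
  Filter.Eventually.and (e.open_target.mem_nhds hy) <|
    (e.continuousAt_symm hy).eventually (e'.open_source.mem_nhds hy')

variable [ChartedSpace (EuclideanSpace ℝ (Fin n)) M]

/-- The derivative of the chart `e`, as a linear map of the model space. -/
def chartD (e : OpenPartialHomeomorph M (EuclideanSpace ℝ (Fin n))) (p : M) :
    EuclideanSpace ℝ (Fin n) →L[ℝ] EuclideanSpace ℝ (Fin n) :=
  mfderiv (𝓡 n) (𝓡 n) e p

variable [IsManifold (𝓡 n) 2 M] (g : C1Metric n M)
  {e e' : OpenPartialHomeomorph M (EuclideanSpace ℝ (Fin n))} {y : EuclideanSpace ℝ (Fin n)}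

lemma contDiffAt_chartChange
    (he : e ∈ atlas (EuclideanSpace ℝ (Fin n)) M)
    (he' : e' ∈ atlas (EuclideanSpace ℝ (Fin n)) M) (hy : y ∈ e.target)
    (hy' : e.symm y ∈ e'.source) : ContDiffAt ℝ 2 (fun z => e' (e.symm z)) y := by
  have h1 : ContMDiffAt (𝓡 n) (𝓡 n) 2 e.symm y :=
    (contMDiffOn_symm_of_mem_maximalAtlas
      (IsManifold.subset_maximalAtlas (I := 𝓡 n) (n := 2) he)).contMDiffAt
        (e.open_target.mem_nhds hy)
  have h2 : ContMDiffAt (𝓡 n) (𝓡 n) 2 e' (e.symm y) :=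
    (contMDiffOn_of_mem_maximalAtlas
      (IsManifold.subset_maximalAtlas (I := 𝓡 n) (n := 2) he')).contMDiffAt
        (e'.open_source.mem_nhds hy')
  exact contMDiffAt_iff_contDiffAt.1 (h2.comp y h1)

lemma symmD_chartChange
    (he : e ∈ atlas (EuclideanSpace ℝ (Fin n)) M)
    (he' : e' ∈ atlas (EuclideanSpace ℝ (Fin n)) M) (hy : y ∈ e.target)
    (hy' : e.symm y ∈ e'.source) (u : EuclideanSpace ℝ (Fin n)) :
    symmD e y u = symmD e' (e' (e.symm y)) (fderiv ℝ (fun z => e' (e.symm z)) y u) := by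
  have hφ : MDifferentiableAt (𝓡 n) (𝓡 n) (fun z => e' (e.symm z)) y :=
    ((contDiffAt_chartChange he he' hy hy').differentiableAt two_ne_zero).mdifferentiableAt
  have hs : MDifferentiableAt (𝓡 n) (𝓡 n) e'.symm (e' (e.symm y)) :=
    mdifferentiableAt_atlas_symm he' (e'.map_source hy')
  have h1 : e.symm =ᶠ[𝓝 y] e'.symm ∘ fun z => e' (e.symm z) := by
    filter_upwards [eventually_chartChange hy hy'] with z hz
    exact (e'.left_inv hz.2).symm
  have h2 : mfderiv (𝓡 n) (𝓡 n) e.symm y =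
      mfderiv (𝓡 n) (𝓡 n) (e'.symm ∘ fun z => e' (e.symm z)) y := h1.mfderiv_eq
  have h3 := mfderiv_comp y hs hφ
  have h4 : mfderiv (𝓡 n) (𝓡 n) (fun z => e' (e.symm z)) y =
    fderiv ℝ (fun z => e' (e.symm z)) y := mfderiv_eq_fderiv
  rw [h4] at h3
  exact DFunLike.congr_fun (h2.trans h3) u

lemma gramForm_chartChange
    (he : e ∈ atlas (EuclideanSpace ℝ (Fin n)) M)
    (he' : e' ∈ atlas (EuclideanSpace ℝ (Fin n)) M) (hy : y ∈ e.target)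
    (hy' : e.symm y ∈ e'.source) (u v : EuclideanSpace ℝ (Fin n)) :
    gramForm g e y u v = gramForm g e' (e' (e.symm y))
      (fderiv ℝ (fun z => e' (e.symm z)) y u) (fderiv ℝ (fun z => e' (e.symm z)) y v) := by
  simp only [gramForm, ← symmD_chartChange he he' hy hy', e'.left_inv hy']

/-- The product rule for `gramForm_chartChange`: the vectors transported by the chart change vary
with the base point, which produces the second derivatives. These exist because the atlas is C². -/
lemma fderiv_gramForm_chartChange
    (he : e ∈ atlas (EuclideanSpace ℝ (Fin n)) M)
    (he' : e' ∈ atlas (EuclideanSpace ℝ (Fin n)) M) (hy : y ∈ e.target)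
    (hy' : e.symm y ∈ e'.source) (w u v : EuclideanSpace ℝ (Fin n)) :
    fderiv ℝ (fun z => gramForm g e z u v) y w =
      gramForm g e' (e' (e.symm y)) (fderiv ℝ (fderiv ℝ (fun z => e' (e.symm z))) y w u)
        (fderiv ℝ (fun z => e' (e.symm z)) y v) +
      gramForm g e' (e' (e.symm y)) (fderiv ℝ (fun z => e' (e.symm z)) y u)
        (fderiv ℝ (fderiv ℝ (fun z => e' (e.symm z))) y w v) +
      fderiv ℝ (fun z => gramForm g e' z (fderiv ℝ (fun z => e' (e.symm z)) y u)
        (fderiv ℝ (fun z => e' (e.symm z)) y v)) (e' (e.symm y))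
        (fderiv ℝ (fun z => e' (e.symm z)) y w) := by
  set φ := fun z => e' (e.symm z) with hφ
  have hC := contDiffAt_chartChange he he' hy hy'
  have h1 : HasFDerivAt φ (fderiv ℝ φ y) y := (hC.differentiableAt two_ne_zero).hasFDerivAt
  have h2 : HasFDerivAt (fderiv ℝ φ) (fderiv ℝ (fderiv ℝ φ) y) y :=
    ((hC.fderiv_right (m := 1) (by norm_num)).differentiableAt one_ne_zero).hasFDerivAt
  -- Both sides are restricted to the line `y + τ • w` and compared through uniqueness of the
  -- derivative at `τ = 0`.
  have hl : HasDerivAt (fun τ : ℝ => y + τ • w) w 0 := by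
    simpa using ((hasDerivAt_id (0 : ℝ)).smul_const w).const_add y
  have hl0 : y + (0 : ℝ) • w = y := by simp
  have hG : HasDerivAt (fun τ : ℝ => gramForm g e (y + τ • w) u v)
      (fderiv ℝ (fun z => gramForm g e z u v) y w) 0 := by
    have hd := (differentiableAt_gramForm g he hy u v).hasFDerivAt
    rw [← hl0] at hd
    have h3 := hd.comp_hasDerivAt (0 : ℝ) hl
    rw [hl0] at h3
    exact h3
  have h1' : HasDerivAt (fun τ : ℝ => φ (y + τ • w)) (fderiv ℝ φ y w) 0 := by
    have hd := h1
    rw [← hl0] at hd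
    have h3 := hd.comp_hasDerivAt (0 : ℝ) hl
    rw [hl0] at h3
    exact h3
  have h2' : ∀ a, HasDerivAt (fun τ : ℝ => fderiv ℝ φ (y + τ • w) a)
      (fderiv ℝ (fderiv ℝ φ) y w a) 0 := by
    intro a
    have hd := h2
    rw [← hl0] at hd
    have h3 := hd.comp_hasDerivAt (0 : ℝ) hl
    rw [hl0] at h3
    exact h3.clm_apply (hasDerivAt_const (0 : ℝ) a) |>.congr_deriv (by simp)
  have hG' := hasDerivAt_gramForm g he' (t := 0) (z := fun τ : ℝ => φ (y + τ • w))
    (by simpa [hl0] using e'.map_source hy') h1' (h2' u) (h2' v)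
  simp only [hl0] at hG'
  refine hG.unique (hG'.congr_of_eventuallyEq ?_)
  have hev : ∀ᶠ τ in 𝓝 (0 : ℝ), y + τ • w ∈ e.target ∧ e.symm (y + τ • w) ∈ e'.source := by
    have hc : Tendsto (fun τ : ℝ => y + τ • w) (𝓝 0) (𝓝 y) := by
      simpa [ContinuousAt] using hl.continuousAt
    exact hc.eventually (eventually_chartChange hy hy')
  filter_upwards [hev] with τ hτ
  exact gramForm_chartChange g he he' hτ.1 hτ.2 u v

lemma surjective_fderiv_chartChange
    (he : e ∈ atlas (EuclideanSpace ℝ (Fin n)) M)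
    (he' : e' ∈ atlas (EuclideanSpace ℝ (Fin n)) M) (hy : y ∈ e.target)
    (hy' : e.symm y ∈ e'.source) :
    Function.Surjective (fderiv ℝ (fun z => e' (e.symm z)) y) := by
  intro w'
  obtain ⟨w, hw⟩ : ∃ w, symmD e y w = symmD e' (e' (e.symm y)) w' :=
    ((mdifferentiable_of_mem_atlas (I := 𝓡 n) he).symm.mfderiv hy).surjective _
  refine ⟨w, symmD_injective he' (e'.map_source hy') ?_⟩
  exact (symmD_chartChange he he' hy hy' w).symm.trans hw

/-- The transformation law of the Christoffel symbols. -/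
lemma chris_chartChange
    (he : e ∈ atlas (EuclideanSpace ℝ (Fin n)) M)
    (he' : e' ∈ atlas (EuclideanSpace ℝ (Fin n)) M) (hy : y ∈ e.target)
    (hy' : e.symm y ∈ e'.source) (u v : EuclideanSpace ℝ (Fin n)) :
    fderiv ℝ (fun z => e' (e.symm z)) y (chris g e y u v) =
      chris g e' (e' (e.symm y)) (fderiv ℝ (fun z => e' (e.symm z)) y u)
        (fderiv ℝ (fun z => e' (e.symm z)) y v) +
      fderiv ℝ (fderiv ℝ (fun z => e' (e.symm z))) y u v := by
  have hsymm : ∀ a b, fderiv ℝ (fderiv ℝ (fun z => e' (e.symm z))) y a b =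
      fderiv ℝ (fderiv ℝ (fun z => e' (e.symm z))) y b a := fun a b =>
    ((contDiffAt_chartChange he he' hy hy').isSymmSndFDerivAt (by simp)).eq a b
  refine eq_of_gramForm_eq g he' (e'.map_source hy') fun w' => ?_
  -- The test vector is pulled back to `e`, so that the Koszul formulas in both charts concern
  -- corresponding vectors.
  obtain ⟨w, rfl⟩ := surjective_fderiv_chartChange he he' hy hy' w'
  rw [← gramForm_chartChange g he he' hy hy', gramForm_chris g he hy, gramForm_add_left,
    gramForm_chris g he' (e'.map_source hy')]
  simp only [fderiv_gramForm_chartChange g he he' hy hy']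
  -- By symmetry of the second derivative, four of the six second-order terms cancel. The two left
  -- agree and give the inhomogeneous term.
  rw [hsymm v u, hsymm w u, hsymm w v, gramForm_comm g e' _ _
    (fderiv ℝ (fderiv ℝ (fun z => e' (e.symm z))) y v w),
    gramForm_comm g e' _ (fderiv ℝ (fun z => e' (e.symm z)) y v)
    (fderiv ℝ (fderiv ℝ (fun z => e' (e.symm z))) y u w)]
  ring

lemma chartD_chartChange
    (he : e ∈ atlas (EuclideanSpace ℝ (Fin n)) M)
    (he' : e' ∈ atlas (EuclideanSpace ℝ (Fin n)) M)
    {p : M} (hp : p ∈ e.source) (hp' : p ∈ e'.source)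
    (v : EuclideanSpace ℝ (Fin n)) :
    chartD e' p v = fderiv ℝ (fun z => e' (e.symm z)) (e p) (chartD e p v) := by
  have hy' : e.symm (e p) ∈ e'.source := by rwa [e.left_inv hp]
  have hφ : MDifferentiableAt (𝓡 n) (𝓡 n) (fun z => e' (e.symm z)) (e p) :=
    ((contDiffAt_chartChange he he' (e.map_source hp) hy').differentiableAt
      two_ne_zero).mdifferentiableAt
  have h1 : e' =ᶠ[𝓝 p] (fun z => e' (e.symm z)) ∘ e := by
    filter_upwards [e.open_source.mem_nhds hp] with q hq
    simp [e.left_inv hq]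
  have h2 : mfderiv (𝓡 n) (𝓡 n) e' p =
      mfderiv (𝓡 n) (𝓡 n) ((fun z => e' (e.symm z)) ∘ e) p := h1.mfderiv_eq
  have h3 := mfderiv_comp p hφ (mdifferentiableAt_atlas he hp)
  have h4 : mfderiv (𝓡 n) (𝓡 n) (fun z => e' (e.symm z)) (e p) =
    fderiv ℝ (fun z => e' (e.symm z)) (e p) := mfderiv_eq_fderiv
  rw [h4] at h3
  exact DFunLike.congr_fun (h2.trans h3) v

end ChartChange

/-! ### Gluing along intervals, and linear differential equations. -/

section LinearODE

/-- Existence and convergence of parallel transport are both cast as transitive relations between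
times, so that they need to be checked only on short pieces of the curve. -/
lemma rel_of_monotone {R : ℝ → ℝ → Prop} {t : ℕ → ℝ} (ht : Monotone t)
    (refl : R (t 0) (t 0))
    (trans : ∀ a b c, a ≤ b → b ≤ c → R a b → R b c → R a c) (m : ℕ)
    (h : ∀ i < m, R (t i) (t (i + 1))) : R (t 0) (t m) := by
  induction m with
  | zero => exact refl
  | succ m ih =>
    exact trans _ _ _ (ht (Nat.zero_le _)) (ht (Nat.le_succ _))
      (ih fun i hi => h i (Nat.lt_succ_of_lt hi)) (h m (Nat.lt_succ_self m))

/-- March from `a` in steps of length `δ`. The induction on `k` reaches every `t` within distance `k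
* δ`. -/
lemma rel_of_uniformly_local {R : ℝ → ℝ → Prop} {a b δ : ℝ} (hab : a ≤ b) (hδ : 0 < δ)
    (trans : ∀ a b c, a ≤ b → b ≤ c → R a b → R b c → R a c)
    (loc : ∀ s t, a ≤ s → s ≤ t → t ≤ b → t - s ≤ δ → R s t) : R a b := by
  have hstep : ∀ k : ℕ, ∀ t, a ≤ t → t ≤ b → t - a ≤ k * δ → R a t := by
    intro k
    induction k with
    | zero =>
      intro t h1 h2 h3
      exact loc a t le_rfl h1 h2 (by simp at h3; linarith)
    | succ k ih =>
      intro t h1 h2 h3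
      push_cast at h3
      by_cases hta : t - δ ≤ a
      · exact loc a t le_rfl h1 h2 (by linarith)
      · push Not at hta
        exact trans a (t - δ) t hta.le (by linarith)
          (ih _ hta.le (by linarith) (by linarith)) (loc _ _ hta.le (by linarith) h2 (by linarith))
  obtain ⟨k, hk⟩ := exists_nat_ge ((b - a) / δ)
  exact hstep k b hab le_rfl (by rwa [div_le_iff₀ hδ] at hk)

variable {X : Type*} [NormedAddCommGroup X] [NormedSpace ℝ X]

/-- Outside a closed piece, differentiability within that piece is vacuous. The pieces interact only
at `b`, where both one-sided derivatives are `f b`. -/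
lemma hasDerivWithinAt_Icc_union {u u₁ u₂ : ℝ → X} {f : ℝ → X} {a b c : ℝ} (hab : a ≤ b)
    (hbc : b ≤ c) (h₁ : EqOn u u₁ (Icc a b)) (h₂ : EqOn u u₂ (Icc b c))
    (d₁ : ∀ t ∈ Icc a b, HasDerivWithinAt u₁ (f t) (Icc a b) t)
    (d₂ : ∀ t ∈ Icc b c, HasDerivWithinAt u₂ (f t) (Icc b c) t) :
    ∀ t ∈ Icc a c, HasDerivWithinAt u (f t) (Icc a c) t := by
  intro t _
  rw [← Icc_union_Icc_eq_Icc hab hbc]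
  refine HasDerivWithinAt.union ?_ ?_
  · by_cases h : t ∈ Icc a b
    · exact (d₁ t h).congr h₁ (h₁ h)
    · exact HasFDerivWithinAt.of_notMem_closure (by rwa [isClosed_Icc.closure_eq])
  · by_cases h : t ∈ Icc b c
    · exact (d₂ t h).congr h₂ (h₂ h)
    · exact HasFDerivWithinAt.of_notMem_closure (by rwa [isClosed_Icc.closure_eq])

/-- Linear differential equations with continuous coefficients have global solutions. -/
theorem exists_solution_linear [CompleteSpace X] {B : ℝ → X →L[ℝ] X} {a b : ℝ} (hab : a ≤ b)
    (hB : ContinuousOn B (Icc a b)) (x₀ : X) :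
    ∃ u : ℝ → X, u a = x₀ ∧ ∀ t ∈ Icc a b, HasDerivWithinAt u (B t (u t)) (Icc a b) t := by
  obtain ⟨C, hC⟩ := isCompact_Icc.exists_bound_of_continuousOn hB
  have hC0 : 0 ≤ C := (norm_nonneg _).trans (hC a (left_mem_Icc.2 hab))
  -- An existence time valid for every initial value `x`: on the ball of radius `‖x‖ + 1` the field
  -- has norm at most `C * (2 * ‖x‖ + 1)`, so in this time a solution moves by at most `(2 * ‖x‖ +
  -- 1) / 2`.
  have hδ : 0 < 1 / (2 * (C + 1)) := by positivity
  -- The initial value is quantified inside the relation, so that a second solution can start where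
  -- the first one ends.
  refine rel_of_uniformly_local (R := fun s t => Icc s t ⊆ Icc a b → ∀ x₀ : X, ∃ u : ℝ → X,
    u s = x₀ ∧ ∀ τ ∈ Icc s t, HasDerivWithinAt u (B τ (u τ)) (Icc s t) τ) hab hδ ?_ ?_
    Subset.rfl x₀
  · intro s t r hst htr h₁ h₂ hsub x
    obtain ⟨u₁, h₁0, h₁⟩ := h₁ ((Icc_subset_Icc_right htr).trans hsub) x
    obtain ⟨u₂, h₂0, h₂⟩ := h₂ ((Icc_subset_Icc_left hst).trans hsub) (u₁ t)
    have e₁ : EqOn (fun τ => if τ ≤ t then u₁ τ else u₂ τ) u₁ (Icc s t) :=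
      fun τ hτ => by simp [hτ.2]
    have e₂ : EqOn (fun τ => if τ ≤ t then u₁ τ else u₂ τ) u₂ (Icc t r) := by
      intro τ hτ
      rcases hτ.1.eq_or_lt with rfl | h
      · simp [h₂0]
      · simp [not_le.2 h]
    refine ⟨fun τ => if τ ≤ t then u₁ τ else u₂ τ, by simp [hst, h₁0], ?_⟩
    refine hasDerivWithinAt_Icc_union hst htr e₁ e₂ (fun τ hτ => ?_) (fun τ hτ => ?_)
    · rw [e₁ hτ]; exact h₁ τ hτ
    · rw [e₂ hτ]; exact h₂ τ hτ
  · intro s t has hst htb hlen hsub x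
    have hx : 0 ≤ ‖x‖ := norm_nonneg x
    have hPL : IsPicardLindelof (fun τ y => B τ y) (⟨s, left_mem_Icc.2 hst⟩ : Icc s t) x
        ⟨‖x‖ + 1, by positivity⟩ 0 ⟨C * (2 * ‖x‖ + 1), by positivity⟩ ⟨C, hC0⟩ := by
      refine ⟨fun τ hτ => ?_, fun y _ => ?_, fun τ hτ y hy => ?_, ?_⟩
      · exact ((B τ).lipschitz.weaken (hC τ (hsub hτ))).lipschitzOnWith
      · exact (hB.mono hsub).clm_apply continuousOn_const
      · have hy' : ‖y‖ ≤ 2 * ‖x‖ + 1 := by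
          have h1 : ‖y - x‖ ≤ ‖x‖ + 1 := mem_closedBall_iff_norm.1 hy
          have h2 := norm_le_norm_add_norm_sub' y x
          linarith
        exact ((B τ).le_opNorm y).trans (mul_le_mul (hC τ (hsub hτ)) hy' (norm_nonneg _) hC0)
      · have h1 : max (t - s) (s - s) = t - s := max_eq_left (by linarith)
        change C * (2 * ‖x‖ + 1) * max (t - s) (s - s) ≤ ‖x‖ + 1 - 0
        rw [h1]
        calc C * (2 * ‖x‖ + 1) * (t - s) ≤ C * (2 * ‖x‖ + 1) * (1 / (2 * (C + 1))) := by
              gcongr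
          _ = (C / (C + 1)) * ((2 * ‖x‖ + 1) / 2) := by field_simp
          _ ≤ 1 * ((2 * ‖x‖ + 1) / 2) := by
              gcongr
              exact (div_le_one (by positivity)).2 (by linarith)
          _ ≤ ‖x‖ + 1 - 0 := by linarith
    exact hPL.exists_eq_forall_mem_Icc_hasDerivWithinAt₀

/-- A continuous function with a continuous derivative off a countable set is differentiable. -/
theorem hasDerivWithinAt_of_off_countable [CompleteSpace X] {u f : ℝ → X} {a b : ℝ} (hab : a ≤ b)
    {S : Set ℝ} (hS : S.Countable) (hu : ContinuousOn u (Icc a b)) (hf : ContinuousOn f (Icc a b))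
    (hd : ∀ t ∈ Ioo a b \ S, HasDerivAt u (f t) t) :
    ∀ t ∈ Icc a b, HasDerivWithinAt u (f t) (Icc a b) t := by
  -- Extending `f` by constants makes its integral differentiable at every real point, the endpoints
  -- included.
  set F : ℝ → X := IccExtend hab ((Icc a b).domRestrict f)
  have hF : Continuous F := (continuousOn_iff_continuous_domRestrict.1 hf).Icc_extend'
  have hFf : EqOn F f (Icc a b) := fun t ht => IccExtend_of_mem hab _ ht
  have hint : ∀ t ∈ Icc a b, u t = u a + ∫ τ in a..t, F τ := by
    intro t ht
    rw [MeasureTheory.integral_eq_of_hasDerivAt_off_countable_of_le u F ht.1 hS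
      (hu.mono (Icc_subset_Icc_right ht.2)) (fun τ hτ => ?_) (hF.intervalIntegrable _ _)]
    · abel
    · have h1 : τ ∈ Ioo a b := ⟨hτ.1.1, hτ.1.2.trans_le ht.2⟩
      rw [hFf (Ioo_subset_Icc_self h1)]
      exact hd τ ⟨h1, hτ.2⟩
  intro t ht
  have h : HasDerivAt (fun s => u a + ∫ τ in a..s, F τ) (F t) t :=
    (intervalIntegral.integral_hasDerivAt_right (hF.intervalIntegrable _ _)
      (hF.stronglyMeasurableAtFilter _ _) hF.continuousAt).const_add _
  rw [← hFf ht]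
  exact h.hasDerivWithinAt.congr hint (hint t ht)

/-- Continuous dependence of the solutions of linear differential equations on the coefficients
and on the initial value. -/
theorem tendsto_solution_linear {A : ℝ → X →L[ℝ] X} {A' : ℕ → ℝ → X →L[ℝ] X} {a b : ℝ}
    (hab : a ≤ b) (hA : ContinuousOn A (Icc a b)) (hA' : TendstoUniformlyOn A' A atTop (Icc a b))
    {u : ℝ → X} {u' : ℕ → ℝ → X}
    (hu : ∀ t ∈ Icc a b, HasDerivWithinAt u (A t (u t)) (Icc a b) t)
    (hu' : ∀ k, ∀ t ∈ Icc a b, HasDerivWithinAt (u' k) (A' k t (u' k t)) (Icc a b) t)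
    (h0 : Tendsto (fun k => u' k a) atTop (𝓝 (u a))) :
    Tendsto (fun k => u' k b) atTop (𝓝 (u b)) := by
  obtain ⟨C, hC⟩ := isCompact_Icc.exists_bound_of_continuousOn hA
  have hcu : ContinuousOn u (Icc a b) := fun t ht => (hu t ht).continuousWithinAt
  obtain ⟨D, hD⟩ := isCompact_Icc.exists_bound_of_continuousOn hcu
  have hC0 : 0 ≤ C := (norm_nonneg _).trans (hC a (left_mem_Icc.2 hab))
  have hD0 : 0 ≤ D := (norm_nonneg _).trans (hD a (left_mem_Icc.2 hab))
  have hIci : ∀ {w : ℝ → X} {w' : X} {t : ℝ}, t ∈ Ico a b → HasDerivWithinAt w w' (Icc a b) t →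
      HasDerivWithinAt w w' (Ici t) t := fun ht h =>
    h.mono_of_mem_nhdsWithin (Icc_mem_nhdsGE_of_mem ht)
  -- Grönwall: `u` solves the `k`-th equation up to the error `(A t - A' k t) (u t)`, of norm at
  -- most `ε * D`. Since `ε ≤ 1`, the constant `C + 1` bounds `A' k`.
  have hgron : ∀ ε, 0 ≤ ε → ε ≤ 1 → ∀ k, (∀ t ∈ Icc a b, dist (A t) (A' k t) ≤ ε) →
      dist (u' k a) (u a) ≤ ε →
      dist (u' k b) (u b) ≤ gronwallBound ε (C + 1) (ε * D) (b - a) := by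
    intro ε hε0 hε1 k hk hk0
    have hlip : ∀ t ∈ Ico a b, LipschitzOnWith ⟨C + 1, by positivity⟩ (fun x => A' k t x) univ := by
      intro t ht
      refine ((A' k t).lipschitz.weaken ?_).lipschitzOnWith
      change ‖A' k t‖ ≤ C + 1
      have h1 := hk t (Ico_subset_Icc_self ht)
      have h2 := hC t (Ico_subset_Icc_self ht)
      have h3 := norm_le_norm_add_norm_sub (A t) (A' k t)
      rw [dist_eq_norm] at h1
      linarith
    have h := dist_le_of_approx_trajectories_ODE_of_mem (v := fun t x => A' k t x)
      (s := fun _ => univ) (f := u' k) (g := u) (f' := fun t => A' k t (u' k t))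
      (g' := fun t => A t (u t)) (εf := 0) (εg := ε * D) (δ := ε) hlip
      (fun t ht => (hu' k t ht).continuousWithinAt)
      (fun t ht => hIci ht (hu' k t (Ico_subset_Icc_self ht))) (fun t _ => by simp)
      (fun _ _ => trivial) hcu (fun t ht => hIci ht (hu t (Ico_subset_Icc_self ht)))
      (fun t ht => by
        have ht' := Ico_subset_Icc_self ht
        rw [dist_eq_norm, ← _root_.sub_apply]
        refine ((A t - A' k t).le_opNorm _).trans ?_
        rw [← dist_eq_norm]
        exact mul_le_mul (hk t ht') (hD t ht') (norm_nonneg _) hε0)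
      (fun _ _ => trivial) hk0 b (right_mem_Icc.2 hab)
    rw [zero_add] at h
    exact h
  have hcont : Tendsto (fun ε => gronwallBound ε (C + 1) (ε * D) (b - a)) (𝓝[>] 0) (𝓝 0) := by
    have h1 : ContinuousAt (fun ε => gronwallBound ε (C + 1) (ε * D) (b - a)) 0 := by
      simp only [gronwallBound_of_K_ne_0 (by positivity : C + 1 ≠ 0)]
      fun_prop
    have h2 : gronwallBound 0 (C + 1) (0 * D) (b - a) = 0 := by
      rw [zero_mul, gronwallBound_ε0_δ0]
    have h3 := h1.tendsto
    rw [h2] at h3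
    exact h3.mono_left nhdsWithin_le_nhds
  rw [Metric.tendsto_atTop']
  intro η hη
  obtain ⟨ε, hε, hε0, hε1⟩ : ∃ ε, gronwallBound ε (C + 1) (ε * D) (b - a) < η ∧ 0 < ε ∧ ε ≤ 1 := by
    have h1 : ∀ᶠ ε in 𝓝[>] (0 : ℝ), ε ∈ Ioc 0 1 := Ioc_mem_nhdsGT one_pos
    obtain ⟨ε, h, h'⟩ := ((hcont.eventually (gt_mem_nhds hη)).and h1).exists
    exact ⟨ε, h, h'.1, h'.2⟩
  have hev := (Metric.tendstoUniformlyOn_iff.1 hA' ε hε0).and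
    (h0.eventually (Metric.ball_mem_nhds _ hε0))
  obtain ⟨N, hN⟩ := eventually_atTop.1 hev
  refine ⟨N, fun k hk => (hgron ε hε0.le hε1 k (fun t ht => ?_) ?_).trans_lt hε⟩
  · exact ((hN k hk.le).1 t ht).le
  · exact (Metric.mem_ball.1 (hN k hk.le).2).le

end LinearODE

/-! ### From C¹-convergence of metrics to convergence of Christoffel symbols. -/

section Convergence

/-- The adjugate formula holds for all matrices with the convention `0⁻¹ = 0`, so the `F i` need not
be invertible. -/
lemma tendsto_matrix_inv {ι m : Type*} [Fintype m] [DecidableEq m] {l : Filter ι}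
    {F : ι → Matrix m m ℝ} {A : Matrix m m ℝ} (hA : A.det ≠ 0) (h : Tendsto F l (𝓝 A)) :
    Tendsto (fun i => (F i)⁻¹) l (𝓝 A⁻¹) := by
  simp only [Matrix.inv_def, Ring.inverse_eq_inv']
  have hd : Tendsto (fun i => (F i).det) l (𝓝 A.det) :=
    ((continuous_id.matrix_det).tendsto A).comp h
  have ha : Tendsto (fun i => (F i).adjugate) l (𝓝 A.adjugate) :=
    ((continuous_id.matrix_adjugate).tendsto A).comp h
  exact (hd.inv₀ hA).smul ha

/-- Joint convergence in index and point passes through products and matrix inverses like any limit.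
On compact sets `tendstoUniformlyOn_of_tendsto_prod` returns from it to uniform convergence. -/
lemma tendsto_prod_of_tendstoUniformlyOn {α β : Type*} [TopologicalSpace α] [UniformSpace β]
    {F : ℕ → α → β} {f : α → β} {s : Set α} (hF : TendstoUniformlyOn F f atTop s)
    (hf : ContinuousOn f s) {t : α} (ht : t ∈ s) :
    Tendsto (fun q : ℕ × α => F q.1 q.2) (atTop ×ˢ 𝓝[s] t) (𝓝 (f t)) := by
  have h1 : Tendsto (fun q : ℕ × α => f q.2) (atTop ×ˢ 𝓝[s] t) (𝓝 (f t)) :=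
    (hf t ht).tendsto.comp tendsto_snd
  exact h1.congr_uniformity ((tendstoUniformlyOn_iff_tendsto.1 hF).mono_left
    (Filter.prod_mono le_rfl inf_le_right))

lemma tendstoUniformlyOn_of_tendsto_prod {α β : Type*} [TopologicalSpace α] [UniformSpace β]
    {F : ℕ → α → β} {f : α → β} {s : Set α} (hs : IsCompact s) (hf : ContinuousOn f s)
    (hF : ∀ t ∈ s, Tendsto (fun q : ℕ × α => F q.1 q.2) (atTop ×ˢ 𝓝[s] t) (𝓝 (f t))) :
    TendstoUniformlyOn F f atTop s := by
  rw [← tendstoLocallyUniformlyOn_iff_tendstoUniformlyOn_of_compact hs,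
    tendstoLocallyUniformlyOn_iff_forall_tendsto]
  intro t ht
  have h1 : Tendsto (fun q : ℕ × α => f q.2) (atTop ×ˢ 𝓝[s] t) (𝓝 (f t)) :=
    (hf t ht).tendsto.comp tendsto_snd
  exact ((h1.prodMk_nhds (hF t ht)).mono_right (nhds_le_uniformity _))

variable {n : ℕ} {M : Type*} [TopologicalSpace M] [ChartedSpace (EuclideanSpace ℝ (Fin n)) M]
  [IsManifold (𝓡 n) 2 M]

lemma continuousOn_coeff (g : C1Metric n M)
    {e : OpenPartialHomeomorph M (EuclideanSpace ℝ (Fin n))}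
    (he : e ∈ atlas (EuclideanSpace ℝ (Fin n)) M) (i j : Fin n) :
    ContinuousOn (coeff g e i j) e.target := fun _ hy =>
  (differentiableAt_gramForm g he hy _ _).continuousAt.continuousWithinAt

lemma continuousOn_fderiv_coeff (g : Met n M)
    {e : OpenPartialHomeomorph M (EuclideanSpace ℝ (Fin n))}
    (he : e ∈ atlas (EuclideanSpace ℝ (Fin n)) M) (i j : Fin n) :
    ContinuousOn (fderiv ℝ (coeff g.1 e i j)) e.target :=
  (g.2 e he i j).continuousOn

lemma det_gram_ne_zero (g : C1Metric n M)
    {e : OpenPartialHomeomorph M (EuclideanSpace ℝ (Fin n))}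
    (he : e ∈ atlas (EuclideanSpace ℝ (Fin n)) M) {y : EuclideanSpace ℝ (Fin n)}
    (hy : y ∈ e.target) : (gram g e y).det ≠ 0 := by
  have h := congrArg Matrix.det (gram_mul_inv g he hy)
  rw [Matrix.det_mul, Matrix.det_one] at h
  exact left_ne_zero_of_mul_eq_one h

variable {g : Met n M} {gk : ℕ → Met n M}
  {e : OpenPartialHomeomorph M (EuclideanSpace ℝ (Fin n))} {K : Set M}

lemma eventually_mem_basicSet
    (hconv : Tendsto gk atTop (𝓝 g)) (he : e ∈ atlas (EuclideanSpace ℝ (Fin n)) M)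
    (hK : IsCompact K) (hKe : K ⊆ e.source) {ε : ℝ} (hε : 0 < ε) :
    ∀ᶠ k in atTop, gk k ∈ Met.basicSet g e K ε := by
  refine hconv.eventually (IsOpen.mem_nhds ?_ fun p _ i j => ?_)
  · exact TopologicalSpace.isOpen_generateFrom_of_mem ⟨g, e, K, ε, he, hK, hKe, hε, rfl⟩
  · simpa using hε

lemma tendstoUniformlyOn_coeff
    (hconv : Tendsto gk atTop (𝓝 g)) (he : e ∈ atlas (EuclideanSpace ℝ (Fin n)) M)
    (hK : IsCompact K) (hKe : K ⊆ e.source) (i j : Fin n) :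
    TendstoUniformlyOn (fun k p => coeff (gk k).1 e i j (e p)) (fun p => coeff g.1 e i j (e p))
      atTop K := by
  rw [Metric.tendstoUniformlyOn_iff]
  intro ε hε
  filter_upwards [eventually_mem_basicSet hconv he hK hKe hε] with k hk p hp
  exact (hk p hp i j).1

lemma tendstoUniformlyOn_fderiv_coeff
    (hconv : Tendsto gk atTop (𝓝 g)) (he : e ∈ atlas (EuclideanSpace ℝ (Fin n)) M)
    (hK : IsCompact K) (hKe : K ⊆ e.source) (i j : Fin n) :
    TendstoUniformlyOn (fun k p => fderiv ℝ (coeff (gk k).1 e i j) (e p))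
      (fun p => fderiv ℝ (coeff g.1 e i j) (e p)) atTop K := by
  rw [Metric.tendstoUniformlyOn_iff]
  intro ε hε
  filter_upwards [eventually_mem_basicSet hconv he hK hKe hε] with k hk p hp
  rw [dist_eq_norm]
  exact (hk p hp i j).2

lemma tendsto_christoffel
    (hconv : Tendsto gk atTop (𝓝 g)) (he : e ∈ atlas (EuclideanSpace ℝ (Fin n)) M)
    (hK : IsCompact K) (hKe : K ⊆ e.source) (k i j : Fin n) {p : M} (hp : p ∈ K) :
    Tendsto (fun q : ℕ × M => christoffel (gk q.1).1 e (e q.2) k i j) (atTop ×ˢ 𝓝[K] p)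
      (𝓝 (christoffel g.1 e (e p) k i j)) := by
  have hcont : ContinuousOn e K := e.continuousOn.mono hKe
  have hmaps : MapsTo e K e.target := fun q hq => e.map_source (hKe hq)
  have hgram : Tendsto (fun q : ℕ × M => gram (gk q.1).1 e (e q.2)) (atTop ×ˢ 𝓝[K] p)
      (𝓝 (gram g.1 e (e p))) := by
    refine tendsto_pi_nhds.2 fun a => tendsto_pi_nhds.2 fun b => ?_
    exact tendsto_prod_of_tendstoUniformlyOn (tendstoUniformlyOn_coeff hconv he hK hKe a b)
      ((continuousOn_coeff g.1 he a b).comp hcont hmaps) hp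
  have hinv := tendsto_matrix_inv (det_gram_ne_zero g.1 he (hmaps hp)) hgram
  have hd : ∀ a b c : Fin n, Tendsto (fun q : ℕ × M => dcoeff (gk q.1).1 e a b c (e q.2))
      (atTop ×ˢ 𝓝[K] p) (𝓝 (dcoeff g.1 e a b c (e p))) := by
    intro a b c
    have h := tendsto_prod_of_tendstoUniformlyOn
      (tendstoUniformlyOn_fderiv_coeff hconv he hK hKe b c)
      ((continuousOn_fderiv_coeff g he b c).comp hcont hmaps) hp
    exact ((ContinuousLinearMap.apply ℝ ℝ (EuclideanSpace.single a (1 : ℝ))).continuous.tendsto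
      _).comp h
  unfold christoffel
  refine tendsto_const_nhds.mul (tendsto_finsetSum _ fun l _ => ?_)
  exact (tendsto_pi_nhds.1 (tendsto_pi_nhds.1 hinv k) l).mul
    (((hd i j l).add (hd j i l)).sub (hd l i j))

end Convergence

/-! ### The coefficient operator of the parallel transport equation. -/

section ConnectionOperator

variable {n : ℕ} {M : Type*} [TopologicalSpace M] [ChartedSpace (EuclideanSpace ℝ (Fin n)) M]
  [IsManifold (𝓡 n) 2 M]

/-- The linear map with the matrix unit at `(k, j)`. -/
def unitOp (k j : Fin n) : EuclideanSpace ℝ (Fin n) →L[ℝ] EuclideanSpace ℝ (Fin n) :=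
  (EuclideanSpace.proj j : EuclideanSpace ℝ (Fin n) →L[ℝ] ℝ).smulRight
    (EuclideanSpace.single k (1 : ℝ))

/-- The coefficient `w ↦ -Γ(ξ, w)` of the equation of parallel transport in the chart `e`. -/
def connOp (g : C1Metric n M) (e : OpenPartialHomeomorph M (EuclideanSpace ℝ (Fin n)))
    (y ξ : EuclideanSpace ℝ (Fin n)) :
    EuclideanSpace ℝ (Fin n) →L[ℝ] EuclideanSpace ℝ (Fin n) :=
  -∑ k, ∑ i, ∑ j, (christoffel g e y k i j * ξ i) • unitOp k j

lemma connOp_apply (g : C1Metric n M) (e : OpenPartialHomeomorph M (EuclideanSpace ℝ (Fin n)))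
    (y ξ w : EuclideanSpace ℝ (Fin n)) : connOp g e y ξ w = -chris g e y ξ w := by
  ext k
  simp [connOp, chris, unitOp, _root_.sum_apply, Finset.sum_apply, Pi.single_apply,
    Finset.sum_ite_eq]

lemma tendsto_connOp {g : Met n M} {gk : ℕ → Met n M} (hconv : Tendsto gk atTop (𝓝 g))
    {e : OpenPartialHomeomorph M (EuclideanSpace ℝ (Fin n))}
    (he : e ∈ atlas (EuclideanSpace ℝ (Fin n)) M) {a b : ℝ} {γ : ℝ → M}
    (hγ : ContinuousOn γ (Icc a b)) (hγe : MapsTo γ (Icc a b) e.source)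
    {ξ : ℝ → EuclideanSpace ℝ (Fin n)} (hξ : ContinuousOn ξ (Icc a b)) {t : ℝ}
    (ht : t ∈ Icc a b) :
    Tendsto (fun q : ℕ × ℝ => connOp (gk q.1).1 e (e (γ q.2)) (ξ q.2)) (atTop ×ˢ 𝓝[Icc a b] t)
      (𝓝 (connOp g.1 e (e (γ t)) (ξ t))) := by
  -- The trace of the curve is the compact set on which the C¹-topology is tested.
  have hK : IsCompact (γ '' Icc a b) := isCompact_Icc.image_of_continuousOn hγ
  have h1 : Tendsto (fun q : ℕ × ℝ => (q.1, γ q.2)) (atTop ×ˢ 𝓝[Icc a b] t)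
      (atTop ×ˢ 𝓝[γ '' Icc a b] (γ t)) :=
    tendsto_fst.prodMk (((hγ t ht).tendsto_nhdsWithin (mapsTo_image γ _)).comp tendsto_snd)
  have h2 : ∀ i, Tendsto (fun q : ℕ × ℝ => ξ q.2 i) (atTop ×ˢ 𝓝[Icc a b] t) (𝓝 (ξ t i)) := by
    intro i
    have h3 : ContinuousWithinAt (fun τ => ξ τ i) (Icc a b) t :=
      (EuclideanSpace.proj i : EuclideanSpace ℝ (Fin n) →L[ℝ] ℝ).continuous.continuousAt
        |>.comp_continuousWithinAt (hξ t ht)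
    exact h3.tendsto.comp tendsto_snd
  have h4 : ∀ k i j, Tendsto (fun q : ℕ × ℝ => christoffel (gk q.1).1 e (e (γ q.2)) k i j)
      (atTop ×ˢ 𝓝[Icc a b] t) (𝓝 (christoffel g.1 e (e (γ t)) k i j)) := by
    intro k i j
    have h3 := (tendsto_christoffel hconv he hK hγe.image_subset k i j
      (mem_image_of_mem γ ht)).comp h1
    simpa only [Function.comp_def] using h3
  have h5 : ∀ k i j, Tendsto (fun q : ℕ × ℝ =>
      (christoffel (gk q.1).1 e (e (γ q.2)) k i j * ξ q.2 i) • unitOp k j)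
      (atTop ×ˢ 𝓝[Icc a b] t) (𝓝 ((christoffel g.1 e (e (γ t)) k i j * ξ t i) • unitOp k j)) :=
    fun k i j => ((h4 k i j).mul (h2 i)).smul_const _
  unfold connOp
  exact (tendsto_finsetSum _ fun k _ => tendsto_finsetSum _ fun i _ =>
    tendsto_finsetSum _ fun j _ => h5 k i j).neg

lemma continuousOn_connOp (g : Met n M)
    {e : OpenPartialHomeomorph M (EuclideanSpace ℝ (Fin n))}
    (he : e ∈ atlas (EuclideanSpace ℝ (Fin n)) M) {a b : ℝ} {γ : ℝ → M}
    (hγ : ContinuousOn γ (Icc a b)) (hγe : MapsTo γ (Icc a b) e.source)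
    {ξ : ℝ → EuclideanSpace ℝ (Fin n)} (hξ : ContinuousOn ξ (Icc a b)) :
    ContinuousOn (fun t => connOp g.1 e (e (γ t)) (ξ t)) (Icc a b) := by
  intro t ht
  -- Continuity is the case of a constant sequence of metrics; the idle index is then projected
  -- away.
  have h := tendsto_connOp (gk := fun _ => g) tendsto_const_nhds he hγ hγe hξ ht
  have h1 : Tendsto (fun τ : ℝ => ((0 : ℕ), τ)) (𝓝[Icc a b] t) (⊤ ×ˢ 𝓝[Icc a b] t) :=
    tendsto_top.prodMk tendsto_id
  have h2 : map Prod.snd ((atTop : Filter ℕ) ×ˢ 𝓝[Icc a b] t) = 𝓝[Icc a b] t := map_snd_prod _ _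
  have h3 : Tendsto (fun t => connOp g.1 e (e (γ t)) (ξ t))
      (map Prod.snd ((atTop : Filter ℕ) ×ˢ 𝓝[Icc a b] t)) (𝓝 (connOp g.1 e (e (γ t)) (ξ t))) :=
    tendsto_map'_iff.2 h
  rwa [h2] at h3

lemma tendstoUniformlyOn_connOp {g : Met n M} {gk : ℕ → Met n M}
    (hconv : Tendsto gk atTop (𝓝 g))
    {e : OpenPartialHomeomorph M (EuclideanSpace ℝ (Fin n))}
    (he : e ∈ atlas (EuclideanSpace ℝ (Fin n)) M) {a b : ℝ} {γ : ℝ → M}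
    (hγ : ContinuousOn γ (Icc a b)) (hγe : MapsTo γ (Icc a b) e.source)
    {ξ : ℝ → EuclideanSpace ℝ (Fin n)} (hξ : ContinuousOn ξ (Icc a b)) :
    TendstoUniformlyOn (fun k t => connOp (gk k).1 e (e (γ t)) (ξ t))
      (fun t => connOp g.1 e (e (γ t)) (ξ t)) atTop (Icc a b) :=
  tendstoUniformlyOn_of_tendsto_prod isCompact_Icc (continuousOn_connOp g he hγ hγe hξ)
    fun _ ht => tendsto_connOp hconv he hγ hγe hξ ht

end ConnectionOperator

/-! ### Tangent vectors in coordinates and the topology of the tangent bundle. -/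

section Reading

variable {n : ℕ} {M : Type*} [TopologicalSpace M] [ChartedSpace (EuclideanSpace ℝ (Fin n)) M]

/-- The coordinates of the tangent vector `v` in the chart `e`. -/
def reading (e : OpenPartialHomeomorph M (EuclideanSpace ℝ (Fin n))) (v : TangentBundle (𝓡 n) M) :
    EuclideanSpace ℝ (Fin n) :=
  chartD e v.proj v.2

/-- The tangent vector at `p` with the coordinates `w` in the chart `e`. -/
def ofReading (e : OpenPartialHomeomorph M (EuclideanSpace ℝ (Fin n))) (p : M)
    (w : EuclideanSpace ℝ (Fin n)) : TangentBundle (𝓡 n) M :=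
  ⟨p, symmD e (e p) w⟩

lemma component_eq_reading (e : OpenPartialHomeomorph M (EuclideanSpace ℝ (Fin n)))
    (v : TangentBundle (𝓡 n) M) (k : Fin n) : component e v k = reading e v k := rfl

/-- Every tangent space unfolds to the model space, so one `v` serves over both points. This is
needed where `c.extend 0` and `c.extend 1` are replaced by `x`. -/
lemma totalSpaceMk_congr {p q : M} (h : p = q) (v : EuclideanSpace ℝ (Fin n)) :
    (⟨p, v⟩ : TangentBundle (𝓡 n) M) = ⟨q, v⟩ := by subst h; rfl

variable [IsManifold (𝓡 n) 2 M]

lemma chartD_symmD {e : OpenPartialHomeomorph M (EuclideanSpace ℝ (Fin n))}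
    (he : e ∈ atlas (EuclideanSpace ℝ (Fin n)) M) {p : M} (hp : p ∈ e.source)
    (w : EuclideanSpace ℝ (Fin n)) : chartD e p (symmD e (e p) w) = w := by
  have h := (mdifferentiable_of_mem_atlas (I := 𝓡 n) he).comp_symm_deriv (e.map_source hp)
  rw [e.left_inv hp] at h
  exact DFunLike.congr_fun h w

lemma symmD_chartD {e : OpenPartialHomeomorph M (EuclideanSpace ℝ (Fin n))}
    (he : e ∈ atlas (EuclideanSpace ℝ (Fin n)) M) {p : M} (hp : p ∈ e.source)
    (w : EuclideanSpace ℝ (Fin n)) : symmD e (e p) (chartD e p w) = w :=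
  DFunLike.congr_fun
    ((mdifferentiable_of_mem_atlas (I := 𝓡 n) he).symm_comp_deriv hp) w

lemma reading_ofReading {e : OpenPartialHomeomorph M (EuclideanSpace ℝ (Fin n))}
    (he : e ∈ atlas (EuclideanSpace ℝ (Fin n)) M) {p : M} (hp : p ∈ e.source)
    (w : EuclideanSpace ℝ (Fin n)) : reading e (ofReading e p w) = w :=
  chartD_symmD he hp w

lemma ofReading_reading {e : OpenPartialHomeomorph M (EuclideanSpace ℝ (Fin n))}
    (he : e ∈ atlas (EuclideanSpace ℝ (Fin n)) M) {v : TangentBundle (𝓡 n) M}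
    (hv : v.proj ∈ e.source) : ofReading e v.proj (reading e v) = v := by
  obtain ⟨p, v⟩ := v
  exact congrArg (TotalSpace.mk p) (symmD_chartD he hv v)

/-- The bundle topology is defined by the trivializations of the preferred charts `chartAt`, which
is why curves are later cut into pieces inside preferred charts. -/
lemma trivializationAt_apply_eq (p₀ : M) {v : TangentBundle (𝓡 n) M}
    (hv : v.proj ∈ (chartAt (EuclideanSpace ℝ (Fin n)) p₀).source) :
    trivializationAt (EuclideanSpace ℝ (Fin n)) (TangentSpace (𝓡 n)) p₀ v =
      (v.proj, reading (chartAt (EuclideanSpace ℝ (Fin n)) p₀) v) := by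
  obtain ⟨p, v⟩ := v
  have hb : p ∈ (trivializationAt (EuclideanSpace ℝ (Fin n)) (TangentSpace (𝓡 n) (M := M))
    p₀).baseSet := by simpa using hv
  have h1 := TangentBundle.continuousLinearMapAt_trivializationAt (I := 𝓡 n) (x₀ := p₀) hv
  have h2 := DFunLike.congr_fun h1 v
  rw [Trivialization.continuousLinearMapAt_apply] at h2
  refine Prod.ext ?_ ?_
  · exact Trivialization.coe_fst' _ hb
  · rw [Trivialization.coe_linearMapAt_of_mem _ hb] at h2
    exact h2.trans (by rw [reading, chartD]; rfl)

/-- Continuity of a vector field along a curve inside a chart domain is continuity of its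
coordinates. -/
lemma tendsto_tangentBundle_iff (p₀ : M) {ι : Type*} {l : Filter ι}
    {s : ι → TangentBundle (𝓡 n) M} {v : TangentBundle (𝓡 n) M}
    (hs : ∀ᶠ i in l, (s i).proj ∈ (chartAt (EuclideanSpace ℝ (Fin n)) p₀).source)
    (hv : v.proj ∈ (chartAt (EuclideanSpace ℝ (Fin n)) p₀).source) :
    Tendsto s l (𝓝 v) ↔ Tendsto (fun i => (s i).proj) l (𝓝 v.proj) ∧
      Tendsto (fun i => reading (chartAt (EuclideanSpace ℝ (Fin n)) p₀) (s i)) l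
        (𝓝 (reading (chartAt (EuclideanSpace ℝ (Fin n)) p₀) v)) := by
  have hsrc : v ∈ (trivializationAt (EuclideanSpace ℝ (Fin n)) (TangentSpace (𝓡 n)) p₀).source := by
    rw [Trivialization.mem_source]; simpa using hv
  rw [Trivialization.tendsto_nhds_iff _ hsrc, trivializationAt_apply_eq p₀ hv]
  refine and_congr_right fun _ => tendsto_congr' ?_
  filter_upwards [hs] with i hi
  simp only [trivializationAt_apply_eq p₀ hi]

lemma continuousOn_tangentBundle_iff (p₀ : M) {a b : ℝ} {γ : ℝ → M}
    (hγ : ContinuousOn γ (Icc a b))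
    (hγe : MapsTo γ (Icc a b) (chartAt (EuclideanSpace ℝ (Fin n)) p₀).source)
    {s : ℝ → TangentBundle (𝓡 n) M} (hs : ∀ t ∈ Icc a b, (s t).proj = γ t) :
    ContinuousOn s (Icc a b) ↔
      ContinuousOn (fun t => reading (chartAt (EuclideanSpace ℝ (Fin n)) p₀) (s t)) (Icc a b) := by
  refine forall₂_congr fun t ht => ?_
  have h1 : ∀ᶠ τ in 𝓝[Icc a b] t, (s τ).proj = γ τ := by
    filter_upwards [self_mem_nhdsWithin] with τ hτ using hs τ hτ
  have h2 : ∀ᶠ τ in 𝓝[Icc a b] t, (s τ).proj ∈ (chartAt (EuclideanSpace ℝ (Fin n)) p₀).source := by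
    filter_upwards [self_mem_nhdsWithin] with τ hτ
    rw [hs τ hτ]
    exact hγe hτ
  have h3 : (s t).proj ∈ (chartAt (EuclideanSpace ℝ (Fin n)) p₀).source := by
    rw [hs t ht]; exact hγe ht
  rw [ContinuousWithinAt, tendsto_tangentBundle_iff p₀ h2 h3]
  refine and_iff_right_of_imp fun _ => ?_
  rw [hs t ht]
  exact (tendsto_congr' h1).2 (hγ t ht)

end Reading

/-! ### Parallel fields on intervals: gluing and independence of the chart. -/

section Parallel

variable {n : ℕ} {M : Type*} [TopologicalSpace M] [ChartedSpace (EuclideanSpace ℝ (Fin n)) M]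
  [IsManifold (𝓡 n) 2 M]

/-- `s` is a parallel vector field along the restriction of the curve `γ` to `[a, b]`. -/
def ParallelOn (g : C1Metric n M) (γ : ℝ → M) (a b : ℝ) (s : ℝ → TangentBundle (𝓡 n) M) : Prop :=
  ContinuousOn s (Icc a b) ∧ (∀ t ∈ Icc a b, (s t).proj = γ t) ∧
  ∃ S : Set ℝ, S.Finite ∧ ∀ t ∈ Ioo a b \ S,
    ∀ e ∈ atlas (EuclideanSpace ℝ (Fin n)) M, γ t ∈ e.source → ∀ k : Fin n,
      HasDerivAt (fun τ => component e (s τ) k)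
        (-∑ i, ∑ j, christoffel g e (e (γ t)) k i j *
          deriv (fun τ => e (γ τ) i) t * component e (s t) j) t

variable {g : C1Metric n M} {γ : ℝ → M} {s : ℝ → TangentBundle (𝓡 n) M}

lemma ParallelOn.mono {a b a' b' : ℝ} (h : ParallelOn g γ a b s) (ha : a ≤ a') (hb : b' ≤ b) :
    ParallelOn g γ a' b' s := by
  obtain ⟨h1, h2, S, hS, h3⟩ := h
  exact ⟨h1.mono (Icc_subset_Icc ha hb), fun t ht => h2 t (Icc_subset_Icc ha hb ht), S, hS,
    fun t ht => h3 t ⟨Ioo_subset_Ioo ha hb ht.1, ht.2⟩⟩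

lemma ParallelOn.refl (a : ℝ) (v : EuclideanSpace ℝ (Fin n)) :
    ParallelOn g γ a a (fun _ => ⟨γ a, v⟩) := by
  refine ⟨continuousOn_const, fun t ht => ?_, ∅, finite_empty, fun t ht => ?_⟩
  · rw [Icc_self, mem_singleton_iff] at ht
    rw [ht]
  · simp at ht

lemma ParallelOn.glue {a b c : ℝ} {s₁ s₂ : ℝ → TangentBundle (𝓡 n) M} (hab : a ≤ b) (hbc : b ≤ c)
    (h₁ : ParallelOn g γ a b s₁) (h₂ : ParallelOn g γ b c s₂) (h : s₁ b = s₂ b) :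
    ParallelOn g γ a c (fun t => if t ≤ b then s₁ t else s₂ t) := by
  obtain ⟨c₁, p₁, S₁, hS₁, d₁⟩ := h₁
  obtain ⟨c₂, p₂, S₂, hS₂, d₂⟩ := h₂
  have e₁ : EqOn (fun t => if t ≤ b then s₁ t else s₂ t) s₁ (Icc a b) := fun t ht => by
    simp [ht.2]
  have e₂ : EqOn (fun t => if t ≤ b then s₁ t else s₂ t) s₂ (Icc b c) := by
    intro t ht
    rcases ht.1.eq_or_lt with rfl | hlt
    · simp [h]
    · simp [not_le.2 hlt]
  -- The junction `b` becomes exceptional, since the velocity of the curve may jump there.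
  refine ⟨?_, fun t ht => ?_, insert b (S₁ ∪ S₂), (hS₁.union hS₂).insert b, ?_⟩
  · rw [← Icc_union_Icc_eq_Icc hab hbc]
    exact (c₁.congr e₁).union_of_isClosed (c₂.congr e₂) isClosed_Icc isClosed_Icc
  · by_cases htb : t ≤ b
    · simpa [htb] using p₁ t ⟨ht.1, htb⟩
    · simpa [htb] using p₂ t ⟨(not_le.1 htb).le, ht.2⟩
  · rintro t ⟨ht, htS⟩ e he hte k
    simp only [mem_insert_iff, mem_union, not_or] at htS
    rcases lt_or_gt_of_ne htS.1 with hlt | hgt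
    · have hev : ∀ᶠ τ in 𝓝 t, (fun t => if t ≤ b then s₁ t else s₂ t) τ = s₁ τ := by
        filter_upwards [eventually_lt_nhds hlt] with τ hτ
        simp [hτ.le]
      have hd := d₁ t ⟨⟨ht.1, hlt⟩, htS.2.1⟩ e he hte k
      rw [← hev.self_of_nhds] at hd
      exact hd.congr_of_eventuallyEq (hev.mono fun τ hτ => congrArg (component e · k) hτ)
    · have hev : ∀ᶠ τ in 𝓝 t, (fun t => if t ≤ b then s₁ t else s₂ t) τ = s₂ τ := by
        filter_upwards [eventually_gt_nhds hgt] with τ hτ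
        simp [not_le.2 hτ]
      have hd := d₂ t ⟨⟨hgt, ht.2⟩, htS.2.2⟩ e he hte k
      rw [← hev.self_of_nhds] at hd
      exact hd.congr_of_eventuallyEq (hev.mono fun τ hτ => congrArg (component e · k) hτ)

lemma hasDerivAt_euclidean {f : ℝ → EuclideanSpace ℝ (Fin n)} {f' : EuclideanSpace ℝ (Fin n)}
    {t : ℝ} : HasDerivAt f f' t ↔ ∀ k, HasDerivAt (fun τ => f τ k) (f' k) t := by
  constructor
  · intro hf k
    exact (EuclideanSpace.proj (𝕜 := ℝ) k).hasFDerivAt.comp_hasDerivAt t hf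
  · intro h
    have hsum : ∀ w : EuclideanSpace ℝ (Fin n), w = ∑ i, w i • EuclideanSpace.single i (1 : ℝ) := by
      intro w
      ext k
      simp [Finset.sum_apply, Pi.single_apply]
    have h1 : HasDerivAt (fun τ => ∑ i, f τ i • EuclideanSpace.single i (1 : ℝ))
        (∑ i, f' i • EuclideanSpace.single i (1 : ℝ)) t :=
      HasDerivAt.fun_sum fun i _ => (h i).smul_const _
    rw [← hsum f'] at h1
    exact h1.congr_of_eventuallyEq (Eventually.of_forall fun τ => hsum (f τ))

/-- The equation of parallel transport in components, and in vector form. -/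
lemma hasDerivAt_component_iff {e : OpenPartialHomeomorph M (EuclideanSpace ℝ (Fin n))} {t : ℝ}
    {ξ : EuclideanSpace ℝ (Fin n)} (hγ : HasDerivAt (fun τ => e (γ τ)) ξ t) :
    (∀ k : Fin n, HasDerivAt (fun τ => component e (s τ) k)
        (-∑ i, ∑ j, christoffel g e (e (γ t)) k i j *
          deriv (fun τ => e (γ τ) i) t * component e (s t) j) t) ↔
      HasDerivAt (fun τ => reading e (s τ)) (connOp g e (e (γ t)) ξ (reading e (s t))) t := by
  rw [hasDerivAt_euclidean, connOp_apply]
  refine forall_congr' fun k => ?_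
  have h : ∀ i, deriv (fun τ => e (γ τ) i) t = ξ i := fun i =>
    (hasDerivAt_euclidean.1 hγ i).deriv
  simp only [h, component_eq_reading]
  rfl

/-- The equation of parallel transport is invariant under a change of charts. -/
lemma hasDerivAt_reading_chartChange {e e' : OpenPartialHomeomorph M (EuclideanSpace ℝ (Fin n))}
    (he : e ∈ atlas (EuclideanSpace ℝ (Fin n)) M) (he' : e' ∈ atlas (EuclideanSpace ℝ (Fin n)) M)
    {t : ℝ} (hc : ContinuousAt γ t) (ht : γ t ∈ e.source) (ht' : γ t ∈ e'.source)
    (hs : ∀ᶠ τ in 𝓝 t, (s τ).proj = γ τ) {ξ : EuclideanSpace ℝ (Fin n)}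
    (hγ : HasDerivAt (fun τ => e (γ τ)) ξ t)
    (hd : HasDerivAt (fun τ => reading e (s τ)) (connOp g e (e (γ t)) ξ (reading e (s t))) t) :
    HasDerivAt (fun τ => e' (γ τ)) (fderiv ℝ (fun z => e' (e.symm z)) (e (γ t)) ξ) t ∧
    HasDerivAt (fun τ => reading e' (s τ)) (connOp g e' (e' (γ t))
      (fderiv ℝ (fun z => e' (e.symm z)) (e (γ t)) ξ) (reading e' (s t))) t := by
  set φ := fun z => e' (e.symm z) with hφ
  have hy : e (γ t) ∈ e.target := e.map_source ht
  have hy' : e.symm (e (γ t)) ∈ e'.source := by rwa [e.left_inv ht]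
  have hC := contDiffAt_chartChange he he' hy hy'
  have h1 : HasFDerivAt φ (fderiv ℝ φ (e (γ t))) (e (γ t)) :=
    (hC.differentiableAt two_ne_zero).hasFDerivAt
  have h2 : HasFDerivAt (fderiv ℝ φ) (fderiv ℝ (fderiv ℝ φ) (e (γ t))) (e (γ t)) :=
    ((hC.fderiv_right (m := 1) (by norm_num)).differentiableAt one_ne_zero).hasFDerivAt
  have hev : ∀ᶠ τ in 𝓝 t, γ τ ∈ e.source ∧ γ τ ∈ e'.source :=
    Filter.Eventually.and (hc.eventually (e.open_source.mem_nhds ht))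
      (hc.eventually (e'.open_source.mem_nhds ht'))
  have hγ' : (fun τ => e' (γ τ)) =ᶠ[𝓝 t] fun τ => φ (e (γ τ)) := by
    filter_upwards [hev] with τ hτ
    simp [hφ, e.left_inv hτ.1]
  have hread : (fun τ => reading e' (s τ)) =ᶠ[𝓝 t]
      fun τ => fderiv ℝ φ (e (γ τ)) (reading e (s τ)) := by
    filter_upwards [hev, hs] with τ hτ hsτ
    have h3 := chartD_chartChange he he' (p := (s τ).proj) (by rw [hsτ]; exact hτ.1)
      (by rw [hsτ]; exact hτ.2) (s τ).2
    rw [← hsτ]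
    exact h3
  have h1' := h1.comp_hasDerivAt t hγ
  have h2' := h2.comp_hasDerivAt t hγ
  simp only [Function.comp_def] at h1' h2'
  refine ⟨h1'.congr_of_eventuallyEq hγ', ?_⟩
  have h4 := (h2'.clm_apply hd).congr_of_eventuallyEq hread
  refine h4.congr_deriv ?_
  -- The product rule gives the second derivative of `φ` at `ξ` and the reading, minus `Dφ` applied
  -- to `Γ`. The transformation law turns this into `-Γ` in the chart `e'`.
  have h5 := chris_chartChange g he he' hy hy' ξ (reading e (s t))
  have h6 : reading e' (s t) = fderiv ℝ φ (e (γ t)) (reading e (s t)) := hread.self_of_nhds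
  rw [← hφ, e.left_inv ht] at h5
  rw [h6, connOp_apply, connOp_apply, map_neg, h5]
  abel

end Parallel

/-! ### Existence of parallel transport and its dependence on the metric. -/

section Transport

variable {n : ℕ} {M : Type*} [TopologicalSpace M] [ChartedSpace (EuclideanSpace ℝ (Fin n)) M]

/-- By compactness each C¹ piece of the loop is subdivided into arcs inside preferred charts.
Degenerate arcs are left to `refl`, so `loc` may use derivatives within a nontrivial interval. -/
lemma rel_of_isPiecewiseC1 {x : M} {c : Path x x} (hc : IsPiecewiseC1 n c) {R : ℝ → ℝ → Prop}
    (refl : ∀ a, R a a) (trans : ∀ a b c, a ≤ b → b ≤ c → R a b → R b c → R a c)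
    (loc : ∀ (p₀ : M) (a b : ℝ), a < b → ContMDiffOn 𝓘(ℝ, ℝ) (𝓡 n) 1 c.extend (Icc a b) →
      MapsTo c.extend (Icc a b) (chartAt (EuclideanSpace ℝ (Fin n)) p₀).source → R a b) :
    R 0 1 := by
  obtain ⟨m, t, ht, ht0, htm, hC⟩ := hc
  rw [← ht0, ← htm]
  refine rel_of_monotone ht (refl _) trans m fun i hi => ?_
  have hle := ht (Nat.le_succ i)
  obtain ⟨r, hr0, hr, ⟨N, hN⟩, hsub⟩ := exists_monotone_Icc_subset_open_cover_Icc
    (a := t i) (b := t (i + 1)) hle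
    (c := fun p₀ : M => {τ | c.extend τ ∈ (chartAt (EuclideanSpace ℝ (Fin n)) p₀).source})
    (fun p₀ => (chartAt (EuclideanSpace ℝ (Fin n)) p₀).open_source.preimage
      (c.continuous_extend.comp continuous_subtype_val))
    (fun τ _ => mem_iUnion.2 ⟨c.extend τ, mem_chart_source _ _⟩)
  have hr' : Monotone fun k => (r k : ℝ) := fun _ _ h => hr h
  have h := rel_of_monotone hr' (refl _) trans N fun k _ => ?_
  · simpa only [hr0, hN N le_rfl] using h
  · rcases (hr' (Nat.le_succ k)).eq_or_lt with heq | hlt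
    · rw [show (r (k + 1) : ℝ) = r k from heq.symm]
      exact refl _
    · obtain ⟨p₀, hp₀⟩ := hsub k
      have hsubset : Icc (r k : ℝ) (r (k + 1)) ⊆ Icc (t i) (t (i + 1)) :=
        Icc_subset_Icc (r k).2.1 (r (k + 1)).2.2
      refine loc p₀ _ _ hlt ((hC i hi).mono hsubset) fun τ hτ => ?_
      exact hp₀ (show (⟨τ, hsubset hτ⟩ : Icc (t i) (t (i + 1))) ∈ Icc (r k) (r (k + 1)) from
        ⟨hτ.1, hτ.2⟩)

variable [IsManifold (𝓡 n) 2 M]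

section InChart

variable {γ : ℝ → M} {a b : ℝ} {p₀ : M}

/-- The derivative within the closed interval is one-sided at the ends and continuous up to them,
whereas the two-sided derivative may fail to exist at a break point. -/
lemma exists_velocity
    (hab : a < b) (hγ : ContMDiffOn 𝓘(ℝ, ℝ) (𝓡 n) 1 γ (Icc a b))
    (hγe : MapsTo γ (Icc a b) (chartAt (EuclideanSpace ℝ (Fin n)) p₀).source) :
    ∃ ξ : ℝ → EuclideanSpace ℝ (Fin n), ContinuousOn ξ (Icc a b) ∧
    ∀ t ∈ Ioo a b,
      HasDerivAt (fun τ => chartAt (EuclideanSpace ℝ (Fin n)) p₀ (γ τ)) (ξ t) t := by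
  have h1 : ContMDiffOn (𝓡 n) (𝓡 n) 1 (chartAt (EuclideanSpace ℝ (Fin n)) p₀)
      (chartAt (EuclideanSpace ℝ (Fin n)) p₀).source :=
    (contMDiffOn_of_mem_maximalAtlas (IsManifold.subset_maximalAtlas (I := 𝓡 n) (n := 2)
      (chart_mem_atlas _ p₀))).of_le (by norm_num)
  have h2 : ContDiffOn ℝ 1 (fun τ => chartAt (EuclideanSpace ℝ (Fin n)) p₀ (γ τ)) (Icc a b) :=
    contMDiffOn_iff_contDiffOn.1 (h1.comp hγ hγe)
  refine ⟨derivWithin (fun τ => chartAt (EuclideanSpace ℝ (Fin n)) p₀ (γ τ)) (Icc a b),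
    h2.continuousOn_derivWithin (uniqueDiffOn_Icc hab) le_rfl, fun t ht => ?_⟩
  exact (((h2.differentiableOn one_ne_zero) t (Ioo_subset_Icc_self ht)).hasDerivWithinAt).hasDerivAt
    (Icc_mem_nhds ht.1 ht.2)

lemma exists_parallelOn_chart
    (hab : a < b) (hγ : ContMDiffOn 𝓘(ℝ, ℝ) (𝓡 n) 1 γ (Icc a b))
    (hγe : MapsTo γ (Icc a b) (chartAt (EuclideanSpace ℝ (Fin n)) p₀).source)
    (g : Met n M) :
    ∃ P : EuclideanSpace ℝ (Fin n) →ₗ[ℝ] EuclideanSpace ℝ (Fin n),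
      ∀ v : EuclideanSpace ℝ (Fin n), ∃ s, ParallelOn g.1 γ a b s ∧
        s a = ⟨γ a, v⟩ ∧ s b = ⟨γ b, P v⟩ := by
  obtain ⟨ξ, hξ, hd⟩ := exists_velocity hab hγ hγe
  set e := chartAt (EuclideanSpace ℝ (Fin n)) p₀ with he_def
  have he : e ∈ atlas (EuclideanSpace ℝ (Fin n)) M := chart_mem_atlas _ p₀
  have hA := continuousOn_connOp g he hγ.continuousOn hγe hξ
  -- The equation is solved for operators, starting at the identity. Transport is then linear in the
  -- initial vector by construction.
  obtain ⟨U, hU0, hU⟩ := exists_solution_linear (X := EuclideanSpace ℝ (Fin n) →L[ℝ]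
      EuclideanSpace ℝ (Fin n)) (B := fun t => ContinuousLinearMap.compL ℝ
      (EuclideanSpace ℝ (Fin n)) (EuclideanSpace ℝ (Fin n)) (EuclideanSpace ℝ (Fin n))
      (connOp g.1 e (e (γ t)) (ξ t))) hab.le
    ((ContinuousLinearMap.continuous _).comp_continuousOn hA) (ContinuousLinearMap.id ℝ _)
  have hw : ∀ w, ∀ t ∈ Icc a b, HasDerivWithinAt (fun t => U t w)
      (connOp g.1 e (e (γ t)) (ξ t) (U t w)) (Icc a b) t := by
    intro w t ht
    exact ((hU t ht).clm_apply (hasDerivWithinAt_const t _ w)).congr_deriv (by simp)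
  have ha : a ∈ Icc a b := left_mem_Icc.2 hab.le
  have hb : b ∈ Icc a b := right_mem_Icc.2 hab.le
  refine ⟨(symmD e (e (γ b))).toLinearMap ∘ₗ (U b).toLinearMap ∘ₗ (chartD e (γ a)).toLinearMap,
    fun v => ?_⟩
  set s : ℝ → TangentBundle (𝓡 n) M := fun t => ofReading e (γ t) (U t (chartD e (γ a) v))
    with hs_def
  have hproj : ∀ t, (s t).proj = γ t := fun t => rfl
  have hread : ∀ t ∈ Icc a b, reading e (s t) = U t (chartD e (γ a) v) := fun t ht =>
    reading_ofReading he (hγe ht) _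
  refine ⟨s, ⟨?_, fun t _ => hproj t, ∅, finite_empty, ?_⟩, ?_, rfl⟩
  · rw [continuousOn_tangentBundle_iff p₀ hγ.continuousOn hγe fun t _ => hproj t]
    exact ContinuousOn.congr (fun t ht => (hw _ t ht).continuousWithinAt) hread
  · rintro t ⟨ht, -⟩ e' he' hte'
    have htI := Ioo_subset_Icc_self ht
    have hnhds : Icc a b ∈ 𝓝 t := Icc_mem_nhds ht.1 ht.2
    have hd1 : HasDerivAt (fun τ => reading e (s τ))
        (connOp g.1 e (e (γ t)) (ξ t) (reading e (s t))) t := by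
      rw [hread t htI]
      exact ((hw _ t htI).hasDerivAt hnhds).congr_of_eventuallyEq
        (eventually_of_mem hnhds hread)
    have h := hasDerivAt_reading_chartChange he he' (hγ.continuousOn.continuousAt hnhds)
      (hγe htI) hte' (Eventually.of_forall hproj) (hd t ht) hd1
    exact (hasDerivAt_component_iff h.1).2 h.2
  · have h1 := ofReading_reading he (v := (⟨γ a, v⟩ : TangentBundle (𝓡 n) M)) (hγe ha)
    rw [← h1]
    simp only [hs_def, hU0]
    rfl

/-- Continuity of the field removes the exceptional set, so the equation holds on the whole closed
interval and the comparison of solutions applies. -/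
lemma ParallelOn.hasDerivWithinAt_reading {g : Met n M} {s : ℝ → TangentBundle (𝓡 n) M}
    (hs : ParallelOn g.1 γ a b s)
    (hab : a < b) (hγ : ContMDiffOn 𝓘(ℝ, ℝ) (𝓡 n) 1 γ (Icc a b))
    (hγe : MapsTo γ (Icc a b) (chartAt (EuclideanSpace ℝ (Fin n)) p₀).source)
    {ξ : ℝ → EuclideanSpace ℝ (Fin n)}
    (hξ : ContinuousOn ξ (Icc a b)) (hd : ∀ t ∈ Ioo a b,
      HasDerivAt (fun τ => chartAt (EuclideanSpace ℝ (Fin n)) p₀ (γ τ)) (ξ t) t) :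
    ∀ t ∈ Icc a b, HasDerivWithinAt
      (fun τ => reading (chartAt (EuclideanSpace ℝ (Fin n)) p₀) (s τ))
      (connOp g.1 (chartAt (EuclideanSpace ℝ (Fin n)) p₀)
        (chartAt (EuclideanSpace ℝ (Fin n)) p₀ (γ t)) (ξ t)
        (reading (chartAt (EuclideanSpace ℝ (Fin n)) p₀) (s t))) (Icc a b) t := by
  obtain ⟨hc, hp, S, hS, hpar⟩ := hs
  have hcr := (continuousOn_tangentBundle_iff p₀ hγ.continuousOn hγe hp).1 hc
  have he : chartAt (EuclideanSpace ℝ (Fin n)) p₀ ∈ atlas (EuclideanSpace ℝ (Fin n)) M :=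
    chart_mem_atlas _ p₀
  refine hasDerivWithinAt_of_off_countable hab.le hS.countable hcr
    ((continuousOn_connOp g he hγ.continuousOn hγe hξ).clm_apply hcr) fun t ht => ?_
  exact (hasDerivAt_component_iff (hd t ht.1)).1
    (hpar t ht _ he (hγe (Ioo_subset_Icc_self ht.1)))

lemma tendsto_parallelOn_chart
    (hab : a < b) (hγ : ContMDiffOn 𝓘(ℝ, ℝ) (𝓡 n) 1 γ (Icc a b))
    (hγe : MapsTo γ (Icc a b) (chartAt (EuclideanSpace ℝ (Fin n)) p₀).source)
    {g : Met n M} {gk : ℕ → Met n M}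
    (hconv : Tendsto gk atTop (𝓝 g)) {s : ℝ → TangentBundle (𝓡 n) M}
    {sk : ℕ → ℝ → TangentBundle (𝓡 n) M} (hs : ParallelOn g.1 γ a b s)
    (hsk : ∀ k, ParallelOn (gk k).1 γ a b (sk k))
    (h0 : Tendsto (fun k => sk k a) atTop (𝓝 (s a))) :
    Tendsto (fun k => sk k b) atTop (𝓝 (s b)) := by
  obtain ⟨ξ, hξ, hd⟩ := exists_velocity hab hγ hγe
  have he : chartAt (EuclideanSpace ℝ (Fin n)) p₀ ∈ atlas (EuclideanSpace ℝ (Fin n)) M :=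
    chart_mem_atlas _ p₀
  have hin : ∀ {g' : Met n M} {s' : ℝ → TangentBundle (𝓡 n) M} (_ : ParallelOn g'.1 γ a b s')
      {t : ℝ} (_ : t ∈ Icc a b),
      (s' t).proj ∈ (chartAt (EuclideanSpace ℝ (Fin n)) p₀).source := by
    intro g' s' h t ht
    rw [h.2.1 t ht]
    exact hγe ht
  have ha : a ∈ Icc a b := left_mem_Icc.2 hab.le
  have hb : b ∈ Icc a b := right_mem_Icc.2 hab.le
  rw [tendsto_tangentBundle_iff p₀ (Eventually.of_forall fun k => hin (hsk k) ha) (hin hs ha)] at h0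
  rw [tendsto_tangentBundle_iff p₀ (Eventually.of_forall fun k => hin (hsk k) hb) (hin hs hb)]
  refine ⟨?_, ?_⟩
  · simp only [(hsk _).2.1 b hb, hs.2.1 b hb]
    exact tendsto_const_nhds
  · exact tendsto_solution_linear hab.le
      (continuousOn_connOp g he hγ.continuousOn hγe hξ)
      (tendstoUniformlyOn_connOp hconv he hγ.continuousOn hγe hξ)
      (hs.hasDerivWithinAt_reading hab hγ hγe hξ hd)
      (fun k => (hsk k).hasDerivWithinAt_reading hab hγ hγe hξ hd) h0.2

end InChart

/-- Parallel transport along piecewise `C¹` loops exists. -/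
theorem exists_isParallelTransport (g : Met n M) {x : M} {c : Path x x}
    (hc : IsPiecewiseC1 n c) : ∃ P, IsParallelTransport g.1 c P := by
  have h : ∃ P : EuclideanSpace ℝ (Fin n) →ₗ[ℝ] EuclideanSpace ℝ (Fin n),
      ∀ v : EuclideanSpace ℝ (Fin n), ∃ s, ParallelOn g.1 c.extend 0 1 s ∧
        s 0 = ⟨c.extend 0, v⟩ ∧ s 1 = ⟨c.extend 1, P v⟩ := by
    refine rel_of_isPiecewiseC1 hc (R := fun a b =>
      ∃ P : EuclideanSpace ℝ (Fin n) →ₗ[ℝ] EuclideanSpace ℝ (Fin n),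
      ∀ v : EuclideanSpace ℝ (Fin n), ∃ s, ParallelOn g.1 c.extend a b s ∧
        s a = ⟨c.extend a, v⟩ ∧ s b = ⟨c.extend b, P v⟩) ?_ ?_ ?_
    · exact fun a => ⟨LinearMap.id, fun v => ⟨_, ParallelOn.refl a v, rfl, rfl⟩⟩
    · rintro a b d hab hbd ⟨P₁, h₁⟩ ⟨P₂, h₂⟩
      refine ⟨P₂ ∘ₗ P₁, fun v => ?_⟩
      obtain ⟨s₁, hs₁, h₁a, h₁b⟩ := h₁ v
      obtain ⟨s₂, hs₂, h₂a, h₂b⟩ := h₂ (P₁ v)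
      refine ⟨_, hs₁.glue hab hbd hs₂ (h₁b.trans h₂a.symm), by simp [hab, h₁a], ?_⟩
      rcases hbd.eq_or_lt with rfl | hlt
      · simp only [le_refl, if_true]
        rw [h₁b, ← h₂a, h₂b]
        rfl
      · simp only [not_le.2 hlt, if_false]
        rw [h₂b]
        rfl
    · exact fun p₀ a b hab hγ hγe => exists_parallelOn_chart hab hγ hγe g
  obtain ⟨P, hP⟩ := h
  refine ⟨P, fun v => ?_⟩
  obtain ⟨s, hs, h0, h1⟩ := hP v
  exact ⟨s, hs, h0.trans (totalSpaceMk_congr c.extend_zero v),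
    h1.trans (totalSpaceMk_congr c.extend_one _)⟩

/-- Parallel transport depends continuously on the metric. -/
theorem tendsto_isParallelTransport {g : Met n M} {gk : ℕ → Met n M}
    (hconv : Tendsto gk atTop (𝓝 g)) {x : M} {c : Path x x} (hc : IsPiecewiseC1 n c)
    {P : TangentSpace (𝓡 n) x →ₗ[ℝ] TangentSpace (𝓡 n) x}
    {Pk : ℕ → TangentSpace (𝓡 n) x →ₗ[ℝ] TangentSpace (𝓡 n) x}
    (hP : IsParallelTransport g.1 c P) (hPk : ∀ k, IsParallelTransport (gk k).1 c (Pk k))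
    (v : TangentSpace (𝓡 n) x) : Tendsto (fun k => Pk k v) atTop (𝓝 (P v)) := by
  obtain ⟨s, hs, h0, h1⟩ := hP v
  choose sk hsk hk0 hk1 using fun k => hPk k v
  have h := rel_of_isPiecewiseC1 hc (R := fun a b => ∀ (s : ℝ → TangentBundle (𝓡 n) M)
    (sk : ℕ → ℝ → TangentBundle (𝓡 n) M), ParallelOn g.1 c.extend a b s →
      (∀ k, ParallelOn (gk k).1 c.extend a b (sk k)) →
      Tendsto (fun k => sk k a) atTop (𝓝 (s a)) → Tendsto (fun k => sk k b) atTop (𝓝 (s b)))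
    (fun _ _ _ _ _ h => h)
    (fun a b d hab hbd h₁ h₂ s sk hs hsk h => h₂ s sk (hs.mono hab le_rfl)
      (fun k => (hsk k).mono hab le_rfl)
      (h₁ s sk (hs.mono le_rfl hbd) (fun k => (hsk k).mono le_rfl hbd) h))
    (fun p₀ a b hab hγ hγe s sk hs hsk h => tendsto_parallelOn_chart hab hγ hγe hconv hs hsk h)
    s sk hs hsk (by simp only [hk0, h0]; exact tendsto_const_nhds)
  simp only [hk1, h1] at h
  -- The fibre over `x` carries the topology induced from the tangent bundle, so convergence there
  -- is convergence in `T_xM`.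
  exact (FiberBundle.totalSpaceMk_isInducing (EuclideanSpace ℝ (Fin n))
    (fun p : M => TangentSpace (𝓡 n) p) x).tendsto_nhds_iff.2 h

end Transport

/-! ### Compactness of orthonormal frames and rotations. -/

section Frames

variable {m : Type*} [Fintype m]

/-- The matrices whose rows have norm at most `√C`. -/
lemma isCompact_setOf_diag_le (C : ℝ) :
    IsCompact {A : Matrix m m ℝ | ∀ i, (A * Aᵀ) i i ≤ C} := by
  have hbox : IsCompact (Set.univ.pi fun _ : m => Set.univ.pi fun _ : m =>
      Icc (-√C) √C : Set (Matrix m m ℝ)) :=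
    isCompact_univ_pi fun _ => isCompact_univ_pi fun _ => isCompact_Icc
  refine hbox.of_isClosed_subset ?_ fun (A : Matrix m m ℝ) hA i _ j _ => ?_
  · rw [ofPred_forall]
    exact isClosed_iInter fun i => isClosed_le
      ((continuous_id.matrix_mul continuous_id.matrix_transpose).matrix_elem i i) continuous_const
  · have h1 : A i j ^ 2 ≤ (A * Aᵀ) i i := by
      simp only [Matrix.mul_apply, Matrix.transpose_apply, ← sq]
      exact Finset.single_le_sum (f := fun j => A i j ^ 2) (fun _ _ => sq_nonneg _)
        (Finset.mem_univ j)
    exact abs_le.1 (Real.abs_le_sqrt (h1.trans (hA i)))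

variable [DecidableEq m]

lemma mem_specialOrthogonalGroup_iff_mul_transpose {A : Matrix m m ℝ} :
    A ∈ Matrix.specialOrthogonalGroup m ℝ ↔ A * Aᵀ = 1 ∧ A.det = 1 :=
  and_congr (Matrix.mem_orthogonalGroup_iff m ℝ) Iff.rfl

lemma coe_inv_specialOrthogonalGroup (U : Matrix.specialOrthogonalGroup m ℝ) :
    ((U⁻¹ : Matrix.specialOrthogonalGroup m ℝ) : Matrix m m ℝ) = (U : Matrix m m ℝ)ᵀ := rfl

lemma isClosed_specialOrthogonalGroup :
    IsClosed (Matrix.specialOrthogonalGroup m ℝ : Set (Matrix m m ℝ)) := by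
  have h : (Matrix.specialOrthogonalGroup m ℝ : Set (Matrix m m ℝ)) =
      {A | A * Aᵀ = 1} ∩ {A | A.det = 1} := by
    ext A
    exact mem_specialOrthogonalGroup_iff_mul_transpose
  rw [h]
  exact (isClosed_eq (continuous_id.matrix_mul continuous_id.matrix_transpose)
    continuous_const).inter (isClosed_eq continuous_id.matrix_det continuous_const)

variable {W : Type*} [AddCommGroup W] [Module ℝ W]

lemma toMatrix_self_eq_conj (b₀ b : Module.Basis m ℝ W) (P : W →ₗ[ℝ] W) :
    LinearMap.toMatrix b b P =
      (b₀.toMatrix b)⁻¹ * LinearMap.toMatrix b₀ b₀ P * b₀.toMatrix b := by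
  rw [Matrix.inv_eq_left_inv (b.toMatrix_mul_toMatrix_flip b₀),
    basis_toMatrix_mul_linearMap_toMatrix_mul_basis_toMatrix]

lemma det_bilinForm_toMatrix_ne_zero (b : Module.Basis m ℝ W) {Q : LinearMap.BilinForm ℝ W}
    (hQ : ∀ v, v ≠ 0 → 0 < Q v v) : (LinearMap.BilinForm.toMatrix b Q).det ≠ 0 := by
  rw [← LinearMap.BilinForm.nondegenerate_iff_det_ne_zero]
  refine ⟨fun v hv => ?_, fun v hv => ?_⟩ <;>
  · by_contra h0
    exact (hQ v h0).ne' (hv v)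

lemma exists_basis_toMatrix_eq (b₀ : Module.Basis m ℝ W) {B : Matrix m m ℝ} (hB : B.det ≠ 0) :
    ∃ b : Module.Basis m ℝ W, b₀.toMatrix b = B := by
  refine ⟨b₀.map (Matrix.toLinearEquiv b₀ B (isUnit_iff_ne_zero.2 hB)), ?_⟩
  ext i j
  rw [Module.Basis.toMatrix_apply, Module.Basis.map_apply, Matrix.toLinearEquiv_apply,
    Matrix.toLin_self]
  simp [Finsupp.single_apply]

/-- Frames that are orthonormal for a convergent sequence of inner products subconverge, together
with rotations, to a frame that is orthonormal for the limit; orientations are preserved. -/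
theorem exists_subseq_tendsto_conj {Q : LinearMap.BilinForm ℝ W}
    {Qk : ℕ → LinearMap.BilinForm ℝ W} (hpos : ∀ v, v ≠ 0 → 0 < Q v v)
    (hQ : ∀ v w, Tendsto (fun k => Qk k v w) atTop (𝓝 (Q v w)))
    (or : Orientation ℝ W m) (bk : ℕ → Module.Basis m ℝ W)
    (horth : ∀ k i j, Qk k (bk k i) (bk k j) = if i = j then 1 else 0)
    (hor : ∀ k, (bk k).orientation = or) (Uk : ℕ → Matrix.specialOrthogonalGroup m ℝ) :
    ∃ b : Module.Basis m ℝ W, (∀ i j, Q (b i) (b j) = if i = j then 1 else 0) ∧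
      b.orientation = or ∧ ∃ U : Matrix.specialOrthogonalGroup m ℝ, ∃ φ : ℕ → ℕ, StrictMono φ ∧
        ∀ (P : W →ₗ[ℝ] W) (Pk : ℕ → W →ₗ[ℝ] W),
          (∀ (v : W) (f : W →ₗ[ℝ] ℝ), Tendsto (fun k => f (Pk k v)) atTop (𝓝 (f (P v)))) →
          Tendsto (fun k => (Uk (φ k) : Matrix m m ℝ) *
            LinearMap.toMatrix (bk (φ k)) (bk (φ k)) (Pk (φ k)) *
            ((Uk (φ k))⁻¹ : Matrix.specialOrthogonalGroup m ℝ)) atTop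
            (𝓝 ((U : Matrix m m ℝ) * LinearMap.toMatrix b b P *
              (U⁻¹ : Matrix.specialOrthogonalGroup m ℝ))) := by
  -- A reference basis that already has the right orientation.
  set b₀ := bk 0 with hb₀
  set G := LinearMap.BilinForm.toMatrix b₀ Q with hG
  set Gk := fun k => LinearMap.BilinForm.toMatrix b₀ (Qk k) with hGk
  set B := fun k => b₀.toMatrix (bk k) with hB
  have hGdet : G.det ≠ 0 := det_bilinForm_toMatrix_ne_zero b₀ hpos
  have hGlim : Tendsto Gk atTop (𝓝 G) := by
    refine tendsto_pi_nhds.2 fun i => tendsto_pi_nhds.2 fun j => ?_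
    simpa only [hG, hGk, LinearMap.BilinForm.toMatrix_apply] using hQ (b₀ i) (b₀ j)
  have hBG : ∀ k, (B k)ᵀ * Gk k * B k = 1 := by
    intro k
    rw [hB, hGk, LinearMap.BilinForm.toMatrix_mul_basis_toMatrix]
    ext i j
    rw [LinearMap.BilinForm.toMatrix_apply, horth, Matrix.one_apply]
  -- Orthonormality bounds the frames: the squared row norms of `B k` are the diagonal entries of
  -- `(Gk k)⁻¹`, which converge.
  have hBB : ∀ k, B k * (B k)ᵀ = (Gk k)⁻¹ := by
    intro k
    refine (Matrix.inv_eq_left_inv ?_).symm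
    rw [Matrix.mul_assoc]
    exact mul_eq_one_comm.1 (hBG k)
  have hdiag : ∀ i, ∃ C, ∀ k, (B k * (B k)ᵀ) i i ≤ C := by
    intro i
    have h1 := tendsto_pi_nhds.1 (tendsto_pi_nhds.1 (tendsto_matrix_inv hGdet hGlim) i) i
    obtain ⟨C, hC⟩ := h1.bddAbove_range
    exact ⟨C, fun k => by rw [hBB]; exact hC (mem_range_self k)⟩
  choose C hC using hdiag
  have hcomp := (isCompact_setOf_diag_le (m := m) (∑ i, |C i|)).prod
    (isCompact_setOf_diag_le (m := m) 1)
  have hmem : ∀ k, (B k, (Uk k : Matrix m m ℝ)) ∈ {A : Matrix m m ℝ | ∀ i,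
      (A * Aᵀ) i i ≤ ∑ i, |C i|} ×ˢ {A : Matrix m m ℝ | ∀ i, (A * Aᵀ) i i ≤ 1} := by
    refine fun k => ⟨fun i => ?_, fun i => ?_⟩
    · exact ((hC i k).trans (le_abs_self _)).trans
        (Finset.single_le_sum (f := fun i => |C i|) (fun _ _ => abs_nonneg _) (Finset.mem_univ i))
    · simp [(mem_specialOrthogonalGroup_iff_mul_transpose.1 (Uk k).2).1]
  have : FirstCountableTopology (Matrix m m ℝ) :=
    inferInstanceAs (FirstCountableTopology (m → m → ℝ))
  -- Frames and rotations are extracted together, before any `P` is given, so one `b` and one `U`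
  -- serve all loops.
  obtain ⟨⟨B', U'⟩, -, φ, hφ, hlim⟩ := hcomp.tendsto_subseq hmem
  have hBlim : Tendsto (fun k => B (φ k)) atTop (𝓝 B') := (continuous_fst.tendsto _).comp hlim
  have hUlim : Tendsto (fun k => (Uk (φ k) : Matrix m m ℝ)) atTop (𝓝 U') :=
    (continuous_snd.tendsto _).comp hlim
  have htrans : ∀ {F : ℕ → Matrix m m ℝ} {A : Matrix m m ℝ}, Tendsto F atTop (𝓝 A) →
      Tendsto (fun k => (F k)ᵀ) atTop (𝓝 Aᵀ) := fun h =>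
    ((continuous_id.matrix_transpose).tendsto _).comp h
  have hB'G : B'ᵀ * G * B' = 1 := by
    have h1 := ((htrans hBlim).mul (hGlim.comp hφ.tendsto_atTop)).mul hBlim
    refine tendsto_nhds_unique h1 (tendsto_const_nhds.congr fun k => ?_)
    exact (hBG (φ k)).symm
  have hB'det : B'.det ≠ 0 := by
    have h1 := congrArg Matrix.det hB'G
    rw [Matrix.det_mul, Matrix.det_one] at h1
    exact right_ne_zero_of_mul_eq_one h1
  have hU' : U' ∈ Matrix.specialOrthogonalGroup m ℝ :=
    isClosed_specialOrthogonalGroup.mem_of_tendsto hUlim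
      (Eventually.of_forall fun k => (Uk (φ k)).2)
  obtain ⟨b, hb⟩ := exists_basis_toMatrix_eq b₀ hB'det
  refine ⟨b, fun i j => ?_, ?_, ⟨U', hU'⟩, φ, hφ, fun P Pk hP => ?_⟩
  · rw [← LinearMap.BilinForm.toMatrix_apply, ← LinearMap.BilinForm.toMatrix_mul_basis_toMatrix b₀,
      hb, hB'G, Matrix.one_apply]
  -- The determinants along the sequence are positive, so the limit is nonnegative; being nonzero,
  -- it is positive.
  · have h0 : 0 ≤ B'.det := by
      refine ge_of_tendsto (((continuous_id.matrix_det).tendsto _).comp hBlim)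
        (Eventually.of_forall fun k => ?_)
      have h1 : b₀.orientation = (bk (φ k)).orientation := (hor 0).trans (hor (φ k)).symm
      rw [Module.Basis.orientation_eq_iff_det_pos, Module.Basis.det_apply] at h1
      exact h1.le
    have h1 : b₀.orientation = b.orientation := by
      rw [Module.Basis.orientation_eq_iff_det_pos, Module.Basis.det_apply, hb]
      exact lt_of_le_of_ne h0 hB'det.symm
    exact h1.symm.trans (hor 0)
  · have hPlim : Tendsto (fun k => LinearMap.toMatrix b₀ b₀ (Pk (φ k))) atTop
        (𝓝 (LinearMap.toMatrix b₀ b₀ P)) := by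
      refine tendsto_pi_nhds.2 fun i => tendsto_pi_nhds.2 fun j => ?_
      simp only [LinearMap.toMatrix_apply]
      exact (hP (b₀ j) (b₀.coord i)).comp hφ.tendsto_atTop
    have hconj : ∀ k, LinearMap.toMatrix (bk (φ k)) (bk (φ k)) (Pk (φ k)) =
        (B (φ k))⁻¹ * LinearMap.toMatrix b₀ b₀ (Pk (φ k)) * B (φ k) := fun k =>
      toMatrix_self_eq_conj b₀ _ _
    simp only [coe_inv_specialOrthogonalGroup, hconj]
    rw [toMatrix_self_eq_conj b₀ b, hb]
    exact (hUlim.mul (((tendsto_matrix_inv hB'det hBlim).mul hPlim).mul hBlim)).mul (htrans hUlim)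

end Frames

/-! ### Convergence of the inner products at a point. -/

section Inner

variable {n : ℕ} {M : Type*} [TopologicalSpace M] [ChartedSpace (EuclideanSpace ℝ (Fin n)) M]
  [IsManifold (𝓡 n) 2 M]

lemma modelInner_eq_gramForm (g : C1Metric n M)
    {e : OpenPartialHomeomorph M (EuclideanSpace ℝ (Fin n))}
    (he : e ∈ atlas (EuclideanSpace ℝ (Fin n)) M) {p : M} (hp : p ∈ e.source)
    (v w : EuclideanSpace ℝ (Fin n)) :
    modelInner g p v w = gramForm g e (e p) (chartD e p v) (chartD e p w) := by
  rw [gramForm, symmD_chartD he hp, symmD_chartD he hp, e.left_inv hp]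

/-- Convergence of the coefficients on the compact set `{p}`. -/
lemma tendsto_modelInner {g : Met n M} {gk : ℕ → Met n M} (hconv : Tendsto gk atTop (𝓝 g))
    (p : M) (v w : EuclideanSpace ℝ (Fin n)) :
    Tendsto (fun k => modelInner (gk k).1 p v w) atTop (𝓝 (modelInner g.1 p v w)) := by
  have he : chartAt (EuclideanSpace ℝ (Fin n)) p ∈ atlas (EuclideanSpace ℝ (Fin n)) M :=
    chart_mem_atlas _ p
  have hp := mem_chart_source (EuclideanSpace ℝ (Fin n)) p
  simp only [modelInner_eq_gramForm _ he hp, gramForm_eq_sum]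
  exact tendsto_finsetSum _ fun i _ => tendsto_finsetSum _ fun j _ => tendsto_const_nhds.mul
    ((tendstoUniformlyOn_coeff hconv he isCompact_singleton (singleton_subset_iff.2 hp)
      i j).tendsto_at (mem_singleton p))

/-- The metric `g` at `p` as a bilinear form. -/
def innerForm (g : C1Metric n M) (p : M) : LinearMap.BilinForm ℝ (TangentSpace (𝓡 n) p) :=
  LinearMap.mk₂ ℝ (fun v w => g.inner p v w) (fun _ _ _ => by simp) (fun _ _ _ => by simp)
    (fun _ _ _ => by simp) (fun _ _ _ => by simp)

end Inner

end RiemannianHolonomy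

end

/-! ### Passage to the limit in the holonomy groups. -/

theorem corollary3p2 (n : ℕ) {M : Type*} [TopologicalSpace M]
    [ChartedSpace (EuclideanSpace ℝ (Fin n)) M] [IsManifold (𝓡 n) 2 M]
    (o : RiemannianHolonomy.ManifoldOrientation n M)
    (g : RiemannianHolonomy.Met n M) (gk : ℕ → RiemannianHolonomy.Met n M)
    (H : Subgroup (Matrix.specialOrthogonalGroup (Fin n) ℝ))
    (hH : IsClosed (H : Set (Matrix.specialOrthogonalGroup (Fin n) ℝ))) (x : M)
    (hconv : Tendsto gk atTop (𝓝 g))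
    (hHol : ∀ k, RiemannianHolonomy.HolSubsetUpToConj o (gk k).1 x H) :
    RiemannianHolonomy.HolSubsetUpToConj o g.1 x H := by
  choose bk hbk Uk hUk using hHol
  obtain ⟨b, hb, hbo, U, φ, hφ, hlim⟩ := RiemannianHolonomy.exists_subseq_tendsto_conj
    (Q := RiemannianHolonomy.innerForm g.1 x)
    (Qk := fun k => RiemannianHolonomy.innerForm (gk k).1 x) (g.1.pos x)
    (RiemannianHolonomy.tendsto_modelInner hconv x) (o.at_point x) bk
    (fun k => (hbk k).1) (fun k => (hbk k).2) Uk
  refine ⟨b, ⟨hb, hbo⟩, U, fun P hP => ?_⟩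
  obtain ⟨c, hc, hPc⟩ := hP
  -- The transports for the `gk` along the same loop `c` lie in their holonomy groups and
  -- approximate `P`.
  choose Pk hPk using fun k => RiemannianHolonomy.exists_isParallelTransport (gk k) hc
  have hPlim := RiemannianHolonomy.tendsto_isParallelTransport hconv hc hPc hPk
  have : T2Space (TangentSpace (𝓡 n) x) := inferInstanceAs (T2Space (EuclideanSpace ℝ (Fin n)))
  have : FiniteDimensional ℝ (TangentSpace (𝓡 n) x) :=
    inferInstanceAs (FiniteDimensional ℝ (EuclideanSpace ℝ (Fin n)))
  have hA := hlim P Pk fun v f =>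
    (f.continuous_of_finiteDimensional.tendsto _).comp (hPlim v)
  choose A hAH hAeq using fun k => hUk (φ k) (Pk (φ k)) ⟨c, hc, hPk (φ k)⟩
  simp only [← hAeq] at hA
  -- `H` is closed only inside the special orthogonal group, so the limit is first placed in that
  -- group.
  have hmem : (U : Matrix (Fin n) (Fin n) ℝ) * LinearMap.toMatrix b b P *
      ((U⁻¹ : Matrix.specialOrthogonalGroup (Fin n) ℝ) : Matrix (Fin n) (Fin n) ℝ) ∈
        Matrix.specialOrthogonalGroup (Fin n) ℝ :=
    RiemannianHolonomy.isClosed_specialOrthogonalGroup.mem_of_tendsto hA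
      (Eventually.of_forall fun k => (A k).2)
  exact ⟨⟨_, hmem⟩, hH.mem_of_tendsto (tendsto_subtype_rng.2 hA) (Eventually.of_forall hAH), rfl⟩
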